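/- Let $\mathcal{O}=\mathbf{C}[[\varepsilon]]$, $F=\mathbf{C}((\varepsilon))$ and $\overline F=\bigcup_{n\ge 1}\mathbf{C}((\varepsilon^{1/n}))$, with the valuation $\mathrm{val}:\overline F^{\times}\to\mathbf{Q}$, $\mathrm{val}(\varepsilon)=1$. Fix a compatible family $(\zeta_n)_{n\ge1}$ of primitive $n$-th roots of unity ($\zeta_{mn}^m=\zeta_n$) and let $\tau\in\mathrm{Gal}(\overline F/F)$ be given by $\tau(\varepsilon^{1/n})=\zeta_n\varepsilon^{1/n}$. Let $\gamma\in\mathfrak{gl}_d(\mathcal{O})$ be regular semisimple (its characteristic polynomial is separable over $F$). Choose a diagonal matrix $x=\mathrm{diag}(x_1,\dots,x_d)$ over $\overline F$ conjugate to $\gamma$. To $x$ one attaches the pair $(w,r)$, where $w\in S_d$ is the element with $w(\tau(x))=x$ and $r$ is the function $r(i,j)=\mathrm{val}(x_i-x_j)$ on the roots $(i,j)$, $i\neq j$, of $\mathrm{GL}_d$. Reordering $x$ by $u\in S_d$ replaces $(w,r)$ by $(uwu^{-1}, r\circ u^{-1})$; the class of $(w,r)$ under this action of $S_d$ is the root valuation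 datum of $\gamma$. The branches of $\mathrm{Spf}(\mathcal{O}[\gamma])$ are the quotients of $\mathcal{O}[\gamma]$ by its minimal primes. The branch on which $\gamma$ has the eigenvalue $x_i$ is the one given by the kernel of the $\mathcal{O}$-homomorphism $\mathcal{O}[\gamma]\to\overline F$, $\gamma\mapsto x_i$. A Puiseux parametrization of a branch is an isomorphism of $\mathbf{C}$-algebras of its coordinate ring with the image of $\mathbf{C}[[X,Y]]\to\mathbf{C}[[t]]$, $X\mapsto t^n$, $Y\mapsto\sum_{k>n}a_kt^k$, where $n\geq 1$ and the exponents $k$ with $a_k\ne0$ have no common divisor with $n$ other than $1$. The Puiseux characteristic of the branch is then the tuple $(\beta_0;\beta_1,\dots,\beta_g)$ with $\beta_0=n$ and, as long as $e_\nu=\gcd(\beta_0,\dots,\beta_\nu)\neq1$, $\beta_{\nu+1}=\min\{k: a_k\neq0,\ e_\nu\nmid k\}$. The intersection number of the branches given by two distinct minimal primes $P,Q$ of a ring $A$ is $\dim_{\mathbf{C}}A/(P+Q)$. Two such singularities are called equisingular if there is a bijection between their branches which preserves the Puiseux characteristics of the branches and the intersection numbers of any two distinct branches. Lemma. Let $\gamma,\gamma'\in\mathfrak{gl}_d(\mathcal{O})$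 be regular semisimple with the same root valuation datum. Then $\mathrm{Spf}(\mathcal{O}[\gamma])$ and $\mathrm{Spf}(\mathcal{O}[\gamma'])$ are equisingular. More precisely, the root valuations determine the Puiseux characteristics of the branches and their pairwise intersection numbers: whenever the eigenvalues $x_1,\dots,x_d$ of $\gamma$ and $x'_1,\dots,x'_d$ of $\gamma'$ are ordered so that they give the same pair $(w,r)$, there is a bijection from the branches of $\mathrm{Spf}(\mathcal{O}[\gamma])$ to those of $\mathrm{Spf}(\mathcal{O}[\gamma'])$ that preserves the Puiseux characteristics of the branches and the intersection numbers of any two distinct branches, and that, for every $i$, sends the branch on which $\gamma$ has the eigenvalue $x_i$ to the branch on which $\gamma'$ has the eigenvalue $x'_i$. -/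

import Mathlib

namespace RootValuation

noncomputable section

/-! ## The field of Puiseux series -/

/-- The ring `𝒪 = ℂ⟦ε⟧`. -/
abbrev O : Type := PowerSeries ℂ

/-- The field `F = ℂ((ε))`. -/
abbrev F : Type := LaurentSeries ℂ

/-- The embedding `ℂ((ε^{1/n})) → HahnSeries ℚ ℂ`, which sends the exponent `k` to `k / n`. -/
def rootEmbedding (n : ℕ+) : F →+* HahnSeries ℚ ℂ :=
  HahnSeries.embDomainRingHom
    ((AddMonoidHom.mulRight ((n : ℚ)⁻¹)).comp (Int.castAddHom ℚ))
    (by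
      intro a b h
      have hn : ((n : ℚ)⁻¹) ≠ 0 := by positivity
      simpa [hn] using h)
    (by
      intro a b
      have hn : 0 < ((n : ℚ)⁻¹) := by positivity
      simp [mul_le_mul_iff_left₀ hn])

/-- The algebraic closure `⋃ₙ ℂ((ε^{1/n}))` of `F`, as a subfield of the Hahn series field. -/
def PuiseuxField : Subfield (HahnSeries ℚ ℂ) := ⨆ n : ℕ+, (rootEmbedding n).fieldRange

theorem ofPowerSeries_mem (x : O) : HahnSeries.ofPowerSeries ℚ ℂ x ∈ PuiseuxField := by
  refine (le_iSup (fun n : ℕ+ => (rootEmbedding n).fieldRange) 1) ?_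
  refine ⟨HahnSeries.ofPowerSeries ℤ ℂ x, ?_⟩
  have h : ∀ y : HahnSeries ℕ ℂ,
      HahnSeries.embDomain ⟨⟨fun a : ℤ => (a : ℚ) * ((1 : ℕ+) : ℚ)⁻¹, by
        intro a b h; simpa using h⟩, by intro a b; simp⟩
        (HahnSeries.embDomain (Nat.castOrderEmbedding (α := ℤ)) y) =
      HahnSeries.embDomain (Nat.castOrderEmbedding (α := ℚ)) y := by
    intro y
    ext q
    by_cases hq : ∃ k : ℕ, (k : ℚ) = q
    · obtain ⟨k, rfl⟩ := hq
      have h1 := HahnSeries.embDomain_coeff (f := Nat.castOrderEmbedding (α := ℚ)) (x := y) (a := k)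
      have h2 := HahnSeries.embDomain_coeff (f := Nat.castOrderEmbedding (α := ℤ)) (x := y) (a := k)
      have h3 := HahnSeries.embDomain_coeff (f := (⟨⟨fun a : ℤ => (a : ℚ) * ((1 : ℕ+) : ℚ)⁻¹, by
        intro a b h; simpa using h⟩, by intro a b; simp⟩ : ℤ ↪o ℚ))
        (x := HahnSeries.embDomain (Nat.castOrderEmbedding (α := ℤ)) y) (a := (k : ℤ))
      simp at h1 h2 h3
      rw [h1, ← h2, ← h3]
      simp
    · rw [HahnSeries.embDomain_of_notMem_range (f := Nat.castOrderEmbedding (α := ℚ))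
        (by rintro ⟨k, hk⟩; exact hq ⟨k, hk⟩)]
      by_cases hz : ∃ k : ℤ, (k : ℚ) = q
      · obtain ⟨k, rfl⟩ := hz
        have h3 := HahnSeries.embDomain_coeff (f := (⟨⟨fun a : ℤ => (a : ℚ) * ((1 : ℕ+) : ℚ)⁻¹, by
          intro a b h; simpa using h⟩, by intro a b; simp⟩ : ℤ ↪o ℚ))
          (x := HahnSeries.embDomain (Nat.castOrderEmbedding (α := ℤ)) y) (a := k)
        simp at h3
        simp only [PNat.one_coe, Nat.cast_one]
        rw [HahnSeries.embDomain_of_notMem_range (f := Nat.castOrderEmbedding (α := ℤ))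
          (by rintro ⟨j, hj⟩; exact hq ⟨j, by rw [← hj]; simp⟩)] at h3
        simpa using h3
      · exact HahnSeries.embDomain_of_notMem_range
          (by rintro ⟨k, hk⟩; exact hz ⟨k, by simpa using hk⟩)
  exact h _

/-- The inclusion of `𝒪` in the field of Puiseux series. -/
def toPuiseux : O →+* PuiseuxField :=
  (HahnSeries.ofPowerSeries ℚ ℂ).codRestrict PuiseuxField ofPowerSeries_mem

/-- The valuation, normalized by `val ε = 1` (only used at nonzero elements). -/
def val (x : PuiseuxField) : ℚ := (x : HahnSeries ℚ ℂ).order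

/-- A compatible family of primitive roots of unity `ζ n`, `n ≥ 1`. -/
def IsCompatibleRoots (ζ : ℕ → ℂ) : Prop :=
  (∀ n, 0 < n → IsPrimitiveRoot (ζ n) n) ∧
    ∀ m n, 0 < m → 0 < n → ζ (m * n) ^ m = ζ n

/-- The action of `τ`, `ε^{1/n} ↦ ζ n * ε^{1/n}`: the coefficient at `ε^{a/b}`, in lowest terms,
is multiplied by `(ζ b)^a`. -/
def tau (ζ : ℕ → ℂ) (x : HahnSeries ℚ ℂ) : HahnSeries ℚ ℂ where
  coeff q := ζ q.den ^ q.num * x.coeff q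
  isPWO_support' := x.isPWO_support.mono fun q hq h => hq (by simp [h])

/-! ## Root valuation data -/

/-- The roots of `GL_d`: `(i, j)` with `i ≠ j` is the root `diag(x) ↦ x i - x j`. -/
abbrev Root (d : ℕ) : Type := {p : Fin d × Fin d // p.1 ≠ p.2}

/-- The action of the Weyl group on the roots. -/
def permRoot {d : ℕ} (u : Equiv.Perm (Fin d)) (α : Root d) : Root d :=
  ⟨(u α.1.1, u α.1.2), fun h => α.2 (u.injective h)⟩

/-- Pairs `(w, r)` of an element of the Weyl group and a function on the roots. -/
abbrev RootPair (d : ℕ) : Type := Equiv.Perm (Fin d) × (Root d → ℚ)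

/-- The action `u • (w, r) = (u w u⁻¹, r ∘ u⁻¹)` of the Weyl group. -/
def permPair {d : ℕ} (u : Equiv.Perm (Fin d)) (p : RootPair d) : RootPair d :=
  (u * p.1 * u⁻¹, fun α => p.2 (permRoot u⁻¹ α))

theorem permPair_one {d : ℕ} (p : RootPair d) : permPair 1 p = p := by
  simp [permPair, permRoot]

theorem permPair_mul {d : ℕ} (u v : Equiv.Perm (Fin d)) (p : RootPair d) :
    permPair (u * v) p = permPair u (permPair v p) := by
  simp [permPair, permRoot, mul_assoc]

/-- Two pairs are equivalent if they are in one orbit of the Weyl group. -/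
def rootPairSetoid (d : ℕ) : Setoid (RootPair d) where
  r p q := ∃ u : Equiv.Perm (Fin d), q = permPair u p
  iseqv :=
    { refl := fun p => ⟨1, (permPair_one p).symm⟩
      symm := by
        rintro p _ ⟨u, rfl⟩
        exact ⟨u⁻¹, by rw [← permPair_mul, inv_mul_cancel, permPair_one]⟩
      trans := by
        rintro p _ _ ⟨u, rfl⟩ ⟨v, rfl⟩
        exact ⟨v * u, by rw [permPair_mul]⟩ }

/-- Equivalence classes of pairs `(w, r)`. -/
abbrev RootDatum (d : ℕ) : Type := Quotient (rootPairSetoid d)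

/-- `γ` is regular semisimple: over the field `F`, its characteristic polynomial is separable. -/
def IsRegularSemisimple {d : ℕ} (γ : Matrix (Fin d) (Fin d) O) : Prop :=
  (γ.map (algebraMap O F)).charpoly.Separable

/-- `γ` is conjugate over the field of Puiseux series to the diagonal matrix with entries `x`. -/
def IsDiagonalization {d : ℕ} (γ : Matrix (Fin d) (Fin d) O) (x : Fin d → PuiseuxField) : Prop :=
  ∃ g : GL (Fin d) PuiseuxField,
    (g : Matrix (Fin d) (Fin d) PuiseuxField) * γ.map toPuiseux *
      ((g⁻¹ : GL (Fin d) PuiseuxField) : Matrix (Fin d) (Fin d) PuiseuxField) = Matrix.diagonal x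

/-- `(w, r)` is the pair attached to the diagonal matrix with entries `x`: `w (τ x) = x`, where
`w` acts by `(w y) i = y (w⁻¹ i)`, and `r α = val (α x)`. -/
def IsPairOf (ζ : ℕ → ℂ) {d : ℕ} (x : Fin d → PuiseuxField) (p : RootPair d) : Prop :=
  (∀ i, tau ζ (x (p.1⁻¹ i) : HahnSeries ℚ ℂ) = (x i : HahnSeries ℚ ℂ)) ∧
    ∀ α : Root d, p.2 α = val (x α.1.1 - x α.1.2)

/-- `D` is the root valuation datum of `γ`. -/
def HasRootDatum (ζ : ℕ → ℂ) {d : ℕ} (γ : Matrix (Fin d) (Fin d) O) (D : RootDatum d) : Prop :=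
  ∃ (x : Fin d → PuiseuxField) (p : RootPair d),
    IsDiagonalization γ x ∧ IsPairOf ζ x p ∧ D = Quotient.mk (rootPairSetoid d) p

/-! ## The ring `𝒪[γ]` -/

/-- The subalgebra `𝒪[γ]` of the matrix algebra. -/
def OrderRing {d : ℕ} (γ : Matrix (Fin d) (Fin d) O) : Type :=
  Algebra.adjoin O ({γ} : Set (Matrix (Fin d) (Fin d) O))

instance {d : ℕ} (γ : Matrix (Fin d) (Fin d) O) : CommRing (OrderRing γ) :=
  have : IsMulCommutative (Algebra.adjoin O ({γ} : Set (Matrix (Fin d) (Fin d) O))) :=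
    Algebra.isMulCommutative_adjoin O (by rintro a rfl b rfl; rfl)
  inferInstanceAs (CommRing (Algebra.adjoin O ({γ} : Set (Matrix (Fin d) (Fin d) O))))

instance {d : ℕ} (γ : Matrix (Fin d) (Fin d) O) : Algebra O (OrderRing γ) :=
  inferInstanceAs (Algebra O (Algebra.adjoin O ({γ} : Set (Matrix (Fin d) (Fin d) O))))

instance {d : ℕ} (γ : Matrix (Fin d) (Fin d) O) : Algebra ℂ (OrderRing γ) :=
  inferInstanceAs (Algebra ℂ (Algebra.adjoin O ({γ} : Set (Matrix (Fin d) (Fin d) O))))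

/-- The element `γ` of `𝒪[γ]`. -/
def OrderRing.gen {d : ℕ} (γ : Matrix (Fin d) (Fin d) O) : OrderRing γ :=
  (⟨γ, Algebra.self_mem_adjoin_singleton O γ⟩ :
    Algebra.adjoin O ({γ} : Set (Matrix (Fin d) (Fin d) O)))

/-- `P` is the kernel of the homomorphism `𝒪[γ] → PuiseuxField` that sends `γ` to its
eigenvalue `x`, i.e. it is the branch of `𝒪[γ]` on which `γ` has the eigenvalue `x`. -/
def IsBranchAt {d : ℕ} (γ : Matrix (Fin d) (Fin d) O) (x : PuiseuxField)
    (P : Ideal (OrderRing γ)) : Prop :=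
  ∀ f : Polynomial O,
    Polynomial.aeval (OrderRing.gen γ) f ∈ P ↔ Polynomial.eval₂ toPuiseux x f = 0

/-! ## Plane curve singularities -/

/-- `IsCharacteristicTail b e l`: the list `l` is obtained from the series `b = ∑ aₖ tᵏ` and the
current gcd `e` by the following process. If `e = 1`, stop. Otherwise, the next entry `k` is the
least exponent with `aₖ ≠ 0` that is not divisible by `e`, and `e` is replaced by `gcd e k`. -/
inductive IsCharacteristicTail (b : PowerSeries ℂ) : ℕ → List ℕ → Prop
  | done : IsCharacteristicTail b 1 []
  | step (e k : ℕ) (l : List ℕ) (he : e ≠ 1)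
      (hk : IsLeast {j : ℕ | PowerSeries.coeff j b ≠ 0 ∧ ¬ e ∣ j} k)
      (hl : IsCharacteristicTail b (Nat.gcd e k) l) : IsCharacteristicTail b e (k :: l)

/-- The image of `ℂ⟦X, Y⟧ → ℂ⟦t⟧`, `X ↦ tⁿ`, `Y ↦ b` (for `n > 0` and `b` without constant
term). -/
def parametrizedSubring (n : ℕ) (b : PowerSeries ℂ) : Set (PowerSeries ℂ) :=
  Set.range fun g : MvPowerSeries (Fin 2) ℂ =>
    (MvPowerSeries.subst (![(PowerSeries.X : PowerSeries ℂ) ^ n, b] :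
      Fin 2 → MvPowerSeries Unit ℂ) g : MvPowerSeries Unit ℂ)

/-- `X = tⁿ`, `Y = b(t)`, with `b` of order `> n`, is a parametrization of the branch with
coordinate ring `A`: there is an isomorphism of `ℂ`-algebras of `A` with the image of
`ℂ⟦X, Y⟧` in `ℂ⟦t⟧`. -/
def IsPuiseuxParametrization (A : Type*) [CommRing A] [Algebra ℂ A] (n : ℕ) (b : PowerSeries ℂ) :
    Prop :=
  0 < n ∧ (n : ℕ∞) < b.order ∧
    ∃ φ : A →ₐ[ℂ] PowerSeries ℂ, Function.Injective φ ∧ Set.range φ = parametrizedSubring n b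

/-- The branch with coordinate ring `A` has the Puiseux characteristic `s = (β₀; β₁, …, β_g)`.
That the process which computes `s` stops says that the parametrization is primitive. -/
def HasPuiseuxCharacteristic (A : Type*) [CommRing A] [Algebra ℂ A] (s : List ℕ) : Prop :=
  ∃ (n : ℕ) (b : PowerSeries ℂ) (l : List ℕ),
    IsPuiseuxParametrization A n b ∧ IsCharacteristicTail b n l ∧ s = n :: l

/-- The two branches have the same Puiseux characteristic. -/
def SamePuiseuxCharacteristic (A B : Type*) [CommRing A] [Algebra ℂ A] [CommRing B] [Algebra ℂ B] :
    Prop :=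
  ∃ s : List ℕ, HasPuiseuxCharacteristic A s ∧ HasPuiseuxCharacteristic B s

/-- The intersection number `dim_ℂ A / (P + Q)` of two branches. -/
def intersectionNumber {A : Type*} [CommRing A] [Algebra ℂ A] (P Q : Ideal A) : ℕ∞ :=
  Module.length ℂ (A ⧸ (P ⊔ Q))

/-- The bijection `e` between the branches (the minimal primes) preserves the Puiseux
characteristics, and the intersection numbers of any two distinct branches. -/
def IsEquisingularBijection {A B : Type*} [CommRing A] [Algebra ℂ A] [CommRing B] [Algebra ℂ B]
    (e : minimalPrimes A ≃ minimalPrimes B) : Prop :=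
  (∀ P : minimalPrimes A, SamePuiseuxCharacteristic (A ⧸ P.1) (B ⧸ (e P).1)) ∧
    ∀ P Q : minimalPrimes A, P ≠ Q →
      intersectionNumber P.1 Q.1 = intersectionNumber (e P).1 (e Q).1

/-- Equisingularity of the singularities with coordinate rings `A` and `B`. -/
def Equisingular (A B : Type*) [CommRing A] [Algebra ℂ A] [CommRing B] [Algebra ℂ B] : Prop :=
  ∃ e : minimalPrimes A ≃ minimalPrimes B, IsEquisingularBijection e

end

end RootValuation

namespace RootValuation

open PowerSeries

/-! ## Conjugates of a power series under roots of unity -/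

/-! The relation `w (τ x) = x` says that `τ` sends `x i` to `x (w i)`. If the orbit of `i` under `w`
has `m` elements, `x i` is fixed by `τ^m` and integral over `𝒪`, hence `x i = y(ε^{1/m})` for a
power series `y`. The conjugates `y(ωt)`, `ω^m = 1`, are the expansions of the eigenvalues in the
orbit of `i`. So the branches correspond to the orbits of `w`, the coordinate ring of the branch is
`ℂ⟦t^m⟧[y]`, and the order of `y(ωt) - y(t)` is `m` times a value of `r`.

Puiseux characteristic: each step of the gcd process for a series `b` reads off the order of `b(ωt)
- b(t)` at a primitive `e`-th root of unity `ω`, so these orders determine the characteristic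
(`IsCharacteristicTail.congr`). If `y - y(0)` has order at least `m`, removing its `t^m` term gives
such a `b`. If the order is `q < m`, a change of coordinate turns `y - y(0)` into `t^q` and `t^m`
into a new series `b`. The inversion formula `IsInversePair.order_rescale_pow_add` shows that the
orders for `b` and `y` differ by `m - q` when `ω^q = ω^m = 1`; when `ω^m ≠ 1` the order for `b` is
just `m`.

Intersection numbers: the ideal of branch `j` is generated by its orbit polynomial `f`. Since
`ℂ⟦t^m⟧[y]` has finite codimension in `ℂ⟦t⟧` (`exists_conductor`), the intersection number with
branch `i` is the order of `f` evaluated at the parametrization of branch `i`, that is, the orbit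
size of `i` times the sum of `r(i, j')` over the orbit of `j`. -/

theorem order_rescale_sub_eq_nat (ω : ℂ) (b : PowerSeries ℂ) (k : ℕ) :
    (rescale ω b - b).order = k ↔ IsLeast {j : ℕ | coeff j b ≠ 0 ∧ ω ^ j ≠ 1} k := by
  have h : ∀ j, coeff j (rescale ω b - b) = (ω ^ j - 1) * coeff j b := by
    intro j
    rw [map_sub, coeff_rescale]
    ring
  rw [order_eq_nat]
  simp only [h, IsLeast, lowerBounds, Set.mem_ofPred_eq, mul_ne_zero_iff, sub_ne_zero, mul_eq_zero,
    sub_eq_zero]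
  constructor
  · rintro ⟨⟨h1, h2⟩, h3⟩
    exact ⟨⟨h2, h1⟩, fun {j} ⟨hj, hj'⟩ => not_lt.1 fun hlt => (h3 j hlt).elim hj' hj⟩
  · rintro ⟨⟨h1, h2⟩, h3⟩
    refine ⟨⟨h2, h1⟩, fun j hj => ?_⟩
    by_contra hc
    push Not at hc
    exact absurd (h3 ⟨hc.2, hc.1⟩) (not_le.2 hj)

/-- For a primitive `e`-th root of unity `ω`, `ω^j = 1` exactly when `e ∣ j`. The next
characteristic exponent is therefore the order of `b(ωt) - b(t)`, and `ω^n = 1` because the current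
gcd always divides `n`. -/
theorem IsCharacteristicTail.congr {b b' : PowerSeries ℂ} {n : ℕ} (hn : n ≠ 0)
    (h : ∀ ω : ℂ, ω ^ n = 1 → (rescale ω b - b).order = (rescale ω b' - b').order)
    {e : ℕ} {l : List ℕ} (hl : IsCharacteristicTail b e l) (he : e ∣ n) :
    IsCharacteristicTail b' e l := by
  induction hl with
  | done => exact .done
  | step e k l he' hk _ ih =>
    have he0 : e ≠ 0 := fun h0 => hn (Nat.eq_zero_of_zero_dvd (h0 ▸ he))
    refine .step e k l he' ?_ (ih ((Nat.gcd_dvd_left e k).trans he))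
    have hω := Complex.isPrimitiveRoot_exp e he0
    have hωn : Complex.exp (2 * Real.pi * Complex.I / e) ^ n = 1 :=
      (hω.pow_eq_one_iff_dvd n).2 he
    have h1 := h _ hωn
    have h2 := order_rescale_sub_eq_nat (Complex.exp (2 * Real.pi * Complex.I / e)) b k
    have h3 := order_rescale_sub_eq_nat (Complex.exp (2 * Real.pi * Complex.I / e)) b' k
    simp only [ne_eq, hω.pow_eq_one_iff_dvd] at h2 h3
    exact h3.1 (h1 ▸ h2.2 hk)

/-- As long as `e ≠ 1`, a primitive `e`-th root of unity moves `b`, so some exponent of `b` is not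
divisible by `e`. The gcd then drops strictly, and the process stops. -/
theorem exists_isCharacteristicTail {b : PowerSeries ℂ} {n : ℕ} (hn : n ≠ 0)
    (h : ∀ ω : ℂ, ω ^ n = 1 → ω ≠ 1 → rescale ω b ≠ b) :
    ∃ l, IsCharacteristicTail b n l := by
  suffices H : ∀ e, e ∣ n → ∃ l, IsCharacteristicTail b e l from H n dvd_rfl
  intro e
  induction e using Nat.strong_induction_on with
  | _ e ih =>
    intro he
    have he0 : e ≠ 0 := fun h0 => hn (Nat.eq_zero_of_zero_dvd (h0 ▸ he))
    by_cases he1 : e = 1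
    · exact ⟨[], he1 ▸ .done⟩
    have hω := Complex.isPrimitiveRoot_exp e he0
    have hb := h _ ((hω.pow_eq_one_iff_dvd n).2 he) (hω.ne_one (by omega))
    rw [← sub_ne_zero] at hb
    have h2 := order_rescale_sub_eq_nat (Complex.exp (2 * Real.pi * Complex.I / e)) b
      (rescale (Complex.exp (2 * Real.pi * Complex.I / e)) b - b).order.toNat
    simp only [ne_eq, hω.pow_eq_one_iff_dvd] at h2
    have hk := h2.1 (coe_toNat_order hb).symm
    obtain ⟨l, hl⟩ := ih _ (lt_of_le_of_ne (Nat.gcd_le_left _ (Nat.pos_of_ne_zero he0))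
      fun hg => hk.1.2 (Nat.gcd_eq_left_iff_dvd.1 hg)) ((Nat.gcd_dvd_left _ _).trans he)
    exact ⟨_, .step _ _ _ he1 hk hl⟩

theorem rescale_expand {m : ℕ} (hm : m ≠ 0) {ω : ℂ} (hω : ω ^ m = 1) (f : PowerSeries ℂ) :
    rescale ω (expand m hm f) = expand m hm f := by
  ext j
  rw [coeff_rescale, coeff_expand]
  split_ifs with h
  · obtain ⟨k, rfl⟩ := h
    rw [pow_mul, hω, one_pow, one_mul]
  · rw [mul_zero]

theorem exists_expand_eq {m : ℕ} (hm : m ≠ 0) {f : PowerSeries ℂ}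
    (h : ∀ ω : ℂ, ω ^ m = 1 → rescale ω f = f) : ∃ g, expand m hm g = f := by
  refine ⟨mk fun k => coeff (m * k) f, ?_⟩
  ext j
  rw [coeff_expand]
  split_ifs with hj
  · obtain ⟨k, rfl⟩ := hj
    rw [Nat.mul_div_cancel_left _ (Nat.pos_of_ne_zero hm), coeff_mk]
  · have hω := Complex.isPrimitiveRoot_exp m hm
    have h1 := congrArg (coeff j) (h _ hω.pow_eq_one)
    rw [coeff_rescale] at h1
    by_contra hc
    exact hj ((hω.pow_eq_one_iff_dvd j).1 (mul_right_cancel₀ (Ne.symm hc) (by rw [h1, one_mul])))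

theorem expand_injective {m : ℕ} (hm : m ≠ 0) :
    Function.Injective (expand m hm : PowerSeries ℂ →ₐ[ℂ] PowerSeries ℂ) := by
  intro f g h
  ext k
  rw [← coeff_expand_mul m hm f k, h, coeff_expand_mul]

/-- The polynomials over `ℂ⟦tᵐ⟧` are those invariant under all `t ↦ ω t` with `ωᵐ = 1`. -/
theorem exists_map_expand_eq {m : ℕ} (hm : m ≠ 0) {p : Polynomial (PowerSeries ℂ)}
    (h : ∀ ω : ℂ, ω ^ m = 1 → p.map (rescale ω) = p) :
    ∃ f : Polynomial (PowerSeries ℂ),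
      f.map (expand m hm : PowerSeries ℂ →ₐ[ℂ] PowerSeries ℂ).toRingHom = p := by
  rw [← Polynomial.mem_lifts, Polynomial.lifts_iff_coeff_lifts]
  intro k
  refine exists_expand_eq hm fun ω hω => ?_
  conv_rhs => rw [← h ω hω]
  rw [Polynomial.coeff_map]

/-! ## Roots and compositional inverses of power series -/

theorem order_eq_nat_of_eq_X_pow_mul {f g : PowerSeries ℂ} {k : ℕ} (h : f = X ^ k * g)
    (hg : constantCoeff g ≠ 0) : f.order = k := by
  rw [h, order_mul, order_X_pow, order_zero_of_unit (isUnit_iff_constantCoeff.2 hg.isUnit),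
    add_zero]

theorem exists_eq_X_mul {f : PowerSeries ℂ} (hf : constantCoeff f = 0) :
    ∃ g, f = X * g ∧ constantCoeff g = coeff 1 f := by
  obtain ⟨g, rfl⟩ := X_dvd_iff.2 hf
  refine ⟨g, rfl, ?_⟩
  rw [show 1 = 0 + 1 from rfl, coeff_succ_X_mul, coeff_zero_eq_constantCoeff_apply]

theorem exists_pow_eq_of_constantCoeff_eq_one {u : PowerSeries ℂ} (hu : constantCoeff u = 1)
    {q : ℕ} (hq : q ≠ 0) : ∃ s : PowerSeries ℂ, constantCoeff s = 1 ∧ s ^ q = u := by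
  have hs : HasSubst (u - 1) := HasSubst.of_constantCoeff_zero' (by simp [hu])
  -- The root is `(1 + X)^{1/q}` at `X = u - 1`; its powers follow from additivity of the binomial
  -- series in the exponent.
  have key : ∀ k : ℕ, (PowerSeries.binomialSeries ℂ (1 / q : ℚ)) ^ k =
      PowerSeries.binomialSeries ℂ (k * (1 / q : ℚ)) := by
    intro k
    induction k with
    | zero => simp
    | succ k ih => rw [pow_succ, ih, ← PowerSeries.binomialSeries_add]; push_cast; ring_nf
  have h1 : (PowerSeries.binomialSeries ℂ (1 / q : ℚ)) ^ q = 1 + X := by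
    rw [key, mul_one_div_cancel (by exact_mod_cast hq)]
    simpa using PowerSeries.binomialSeries_nat (R := ℚ) (A := ℂ) 1
  refine ⟨subst (u - 1) (PowerSeries.binomialSeries ℂ (1 / q : ℚ)), ?_, ?_⟩
  · have h2 : PowerSeries.binomialSeries ℂ (1 / q : ℚ) =
        C 1 + (PowerSeries.binomialSeries ℂ (1 / q : ℚ) - C 1) := by ring
    rw [h2, subst_add hs, map_add]
    have h3 := constantCoeff_subst_eq_zero (a := u - 1) (by
      change constantCoeff (u - 1) = 0
      simp [hu]) (PowerSeries.binomialSeries ℂ (1 / q : ℚ) - C 1) (by simp)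
    have h4 : constantCoeff (subst (u - 1) (PowerSeries.binomialSeries ℂ (1 / q : ℚ) - C 1)) = 0 := h3
    rw [h4, ← coe_substAlgHom hs]
    simp
  · rw [← subst_pow hs, h1, ← coe_substAlgHom hs, map_add, map_one, coe_substAlgHom, subst_X hs]
    ring

/-- A power series of order `q` is the `q`-th power of a local parameter. -/
theorem exists_parameter_pow_eq {y : PowerSeries ℂ} {q : ℕ} (hq : q ≠ 0) (hy : y.order = q) :
    ∃ s : PowerSeries ℂ, constantCoeff s = 0 ∧ coeff 1 s ≠ 0 ∧ s ^ q = y := by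
  have hy0 : y ≠ 0 := by
    rintro rfl
    simp at hy
  have h1 : y = X ^ q * divXPowOrder y := by
    have := (X_pow_order_mul_divXPowOrder (f := y)).symm
    rwa [hy] at this
  set v := divXPowOrder y
  have hv : constantCoeff v ≠ 0 := fun h => hy0 (constantCoeff_divXPowOrder_eq_zero_iff.1 h)
  obtain ⟨c, hc⟩ := IsAlgClosed.exists_pow_nat_eq (constantCoeff v) (Nat.pos_of_ne_zero hq)
  have hc0 : c ≠ 0 := by
    rintro rfl
    rw [zero_pow hq] at hc
    exact hv hc.symm
  obtain ⟨s, hs, hs'⟩ := exists_pow_eq_of_constantCoeff_eq_one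
    (u := C (constantCoeff v)⁻¹ * v) (by simp [hv]) hq
  refine ⟨X * (C c * s), by simp, ?_, ?_⟩
  · rw [show 1 = 0 + 1 from rfl, coeff_succ_X_mul, coeff_zero_eq_constantCoeff_apply]
    simp [hs, hc0]
  · rw [mul_pow, mul_pow, hs', ← map_pow, hc, ← mul_assoc (C _), ← map_mul, mul_inv_cancel₀ hv,
      map_one, one_mul, ← h1]

/-- `S` and `T` are inverse to each other under composition. -/
structure IsInversePair (S T : PowerSeries ℂ) : Prop where
  left_zero : constantCoeff S = 0
  right_zero : constantCoeff T = 0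
  subst_right : subst T S = X
  subst_left : subst S T = X

theorem IsInversePair.symm {S T : PowerSeries ℂ} (h : IsInversePair S T) : IsInversePair T S :=
  ⟨h.2, h.1, h.4, h.3⟩

theorem exists_isInversePair {S : PowerSeries ℂ} (h0 : constantCoeff S = 0) (h1 : coeff 1 S ≠ 0) :
    ∃ T : PowerSeries ℂ, IsInversePair S T ∧ coeff 1 T ≠ 0 := by
  refine ⟨substInvOfIsUnit S h1.isUnit,
    ⟨h0, constantCoeff_substInvOfIsUnit _ _, subst_substInvOfIsUnit_right _ h0 _,
      subst_substInvOfIsUnit_left _ h0 _⟩, ?_⟩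
  rw [coeff_one_substInvOfIsUnit]
  exact Units.ne_zero _

/-- The difference `a - b` divides every `a^d - b^d`, so no term of `f(a) - f(b)` contributes below
its order. -/
theorem order_sub_le_order_subst_sub {a b : PowerSeries ℂ} (ha : constantCoeff a = 0)
    (hb : constantCoeff b = 0) (f : PowerSeries ℂ) :
    (a - b).order ≤ PowerSeries.order (subst a f - subst b f) := by
  refine le_order _ _ fun n hn => ?_
  rw [map_sub, coeff_subst' (HasSubst.of_constantCoeff_zero' ha),
    coeff_subst' (HasSubst.of_constantCoeff_zero' hb), sub_eq_zero]
  refine finsum_congr fun d => ?_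
  congr 1
  rw [← sub_eq_zero, ← map_sub]
  obtain ⟨c, hc⟩ := sub_dvd_pow_sub_pow a b d
  refine coeff_of_lt_order _ (hn.trans_le ?_)
  rw [hc, order_mul]
  exact le_self_add

theorem rescale_constantCoeff (ω : ℂ) (f : PowerSeries ℂ) :
    constantCoeff (rescale ω f) = constantCoeff f := by
  rw [← coeff_zero_eq_constantCoeff_apply, coeff_rescale, pow_zero, one_mul,
    coeff_zero_eq_constantCoeff_apply]

/-- Substituting `T` into `S(ωt) - ωS(t)` gives `S(ωT) - ωt` and cannot lower the order. Neither can
applying `T` to both terms of this difference, which gives `ωT(t) - T(ωt)`. -/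
theorem IsInversePair.order_rescale_le {S T : PowerSeries ℂ} (h : IsInversePair S T) (ω : ℂ) :
    (rescale ω S - ω • S).order ≤ (rescale ω T - ω • T).order := by
  have hS := HasSubst.of_constantCoeff_zero' h.left_zero
  have hT := HasSubst.of_constantCoeff_zero' h.right_zero
  have hX : HasSubst (ω • X : PowerSeries ℂ) := HasSubst.smul_X' ω
  have hωT0 : constantCoeff (ω • T) = 0 := by
    rw [smul_eq_C_mul, map_mul, h.right_zero, mul_zero]
  have hωT := HasSubst.of_constantCoeff_zero' hωT0
  have h1 : subst T (rescale ω S - ω • S) = subst (ω • T) S - ω • (X : PowerSeries ℂ) := by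
    rw [subst_sub hT, rescale_eq_subst, subst_comp_subst_apply hX hT, subst_smul hT, subst_smul hT,
      subst_X hT, h.subst_right]
  have h2 : subst (subst (ω • T) S : PowerSeries ℂ) T - subst (ω • (X : PowerSeries ℂ)) T =
      ω • T - rescale ω T := by
    rw [rescale_eq_subst, ← subst_comp_subst_apply hS hωT, h.subst_left, subst_X hωT]
  have h3 := order_sub_le_order_subst_sub (a := subst (ω • T) S) (b := ω • (X : PowerSeries ℂ))
    (constantCoeff_subst_eq_zero hωT0 S h.left_zero) (by simp [smul_eq_C_mul]) T
  rw [h2, ← h1] at h3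
  rw [← order_neg (rescale ω T - _), neg_sub]
  exact (le_order_subst_left' h.right_zero).trans h3

theorem IsInversePair.order_rescale_eq {S T : PowerSeries ℂ} (h : IsInversePair S T) (ω : ℂ) :
    (rescale ω S - ω • S).order = (rescale ω T - ω • T).order :=
  le_antisymm (h.order_rescale_le ω) (h.symm.order_rescale_le ω)

/-- Since `ω^q = 1`, the difference is `A^q - B^q` with `A = S(ωt)` and `B = ωS(t)`. The cofactor of
`A - B` is a sum of `q` terms with the same leading term of degree `q - 1`, which cannot cancel in
characteristic zero. Comparing with `ωS` rather than with `S` is what makes the formula symmetric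
under inversion. -/
theorem order_rescale_pow_sub {S : PowerSeries ℂ} (h0 : constantCoeff S = 0) (h1 : coeff 1 S ≠ 0)
    {q : ℕ} (hq : q ≠ 0) {ω : ℂ} (hω : ω ^ q = 1) :
    (rescale ω (S ^ q) - S ^ q).order = (rescale ω S - ω • S).order + (q - 1 : ℕ) := by
  obtain ⟨s, rfl, hs⟩ := exists_eq_X_mul h0
  rw [← hs] at h1
  have hω0 : ω ≠ 0 := by
    rintro rfl
    rw [zero_pow hq] at hω
    exact zero_ne_one hω
  have hp : (X * s) ^ q = (ω • (X * s)) ^ q := by rw [smul_pow, hω, one_smul]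
  conv_lhs => rw [map_pow]; arg 1; arg 2; rw [hp]
  rw [← (Commute.all _ _).mul_geom_sum₂, order_mul]
  congr 1
  have ha : rescale ω (X * s) = X * (C ω * rescale ω s) := by rw [map_mul, rescale_X]; ring
  have hb : ω • (X * s) = X * (C ω * s) := by rw [smul_eq_C_mul]; ring
  refine order_eq_nat_of_eq_X_pow_mul
    (g := ∑ i ∈ Finset.range q, (C ω * rescale ω s) ^ i * (C ω * s) ^ (q - 1 - i)) ?_ ?_
  · rw [ha, hb, Finset.mul_sum]
    refine Finset.sum_congr rfl fun i hi => ?_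
    have : i + (q - 1 - i) = q - 1 := by
      have := Finset.mem_range.1 hi
      omega
    rw [mul_pow, mul_pow, ← this, pow_add]
    simp only [this]
    ring
  · rw [map_sum, Finset.sum_congr rfl (g := fun _ => (ω * constantCoeff s) ^ (q - 1))]
    · simp [hq, hω0, h1]
    · intro i hi
      have : i + (q - 1 - i) = q - 1 := by
        have := Finset.mem_range.1 hi
        omega
      simp only [map_mul, map_pow, constantCoeff_C, rescale_constantCoeff]
      rw [← pow_add, this]

theorem order_rescale_pow_sub_of_pow_ne_one {T : PowerSeries ℂ} (h0 : constantCoeff T = 0)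
    (h1 : coeff 1 T ≠ 0) {m : ℕ} {ω : ℂ} (hω : ω ^ m ≠ 1) :
    (rescale ω (T ^ m) - T ^ m).order = m := by
  obtain ⟨s, rfl, hs⟩ := exists_eq_X_mul h0
  rw [← hs] at h1
  refine order_eq_nat_of_eq_X_pow_mul (g := (C ω * rescale ω s) ^ m - s ^ m) ?_ ?_
  · rw [map_pow, map_mul, rescale_X]
    ring
  · simp only [map_sub, map_mul, map_pow, constantCoeff_C, rescale_constantCoeff]
    rw [mul_pow, ← sub_one_mul]
    exact mul_ne_zero (sub_ne_zero.2 hω) (pow_ne_zero _ h1)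

/-- The inversion formula: interchanging the roles of `tᵐ` and `y = S ^ q`. -/
theorem IsInversePair.order_rescale_pow_add {S T : PowerSeries ℂ} (h : IsInversePair S T)
    (hS : coeff 1 S ≠ 0) (hT : coeff 1 T ≠ 0) {q m : ℕ} (hq : q ≠ 0) (hm : m ≠ 0) {ω : ℂ}
    (hωq : ω ^ q = 1) (hωm : ω ^ m = 1) :
    (rescale ω (T ^ m) - T ^ m).order + (q - 1 : ℕ) =
      (rescale ω (S ^ q) - S ^ q).order + (m - 1 : ℕ) := by
  rw [order_rescale_pow_sub h.left_zero hS hq hωq, order_rescale_pow_sub h.right_zero hT hm hωm,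
    h.order_rescale_eq ω]
  abel

/-! ## The ring `ℂ⟦tᵐ⟧[y]` and its conductor -/

noncomputable instance (m : ℕ) [NeZero m] : Fintype (rootsOfUnity m ℂ) :=
  Fintype.ofFinite _

/-- `∏ (Y - y (ω t))`, over all `ω` with `ωᵐ = 1`. -/
noncomputable def conjPoly (m : ℕ) [NeZero m] (y : PowerSeries ℂ) : Polynomial (PowerSeries ℂ) :=
  ∏ ω : rootsOfUnity m ℂ, (Polynomial.X - Polynomial.C (rescale ((ω : ℂˣ) : ℂ) y))

theorem coe_rootsOfUnity_pow {m : ℕ} (ω : rootsOfUnity m ℂ) : ((ω : ℂˣ) : ℂ) ^ m = 1 := by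
  have := ω.2
  rw [mem_rootsOfUnity'] at this
  exact this

theorem exists_rootsOfUnity_coe_eq {m : ℕ} [NeZero m] {ω : ℂ} (h : ω ^ m = 1) :
    ∃ ξ : rootsOfUnity m ℂ, ((ξ : ℂˣ) : ℂ) = ω :=
  ⟨rootsOfUnity.mkOfPowEq ω h, rootsOfUnity.coe_mkOfPowEq h⟩

theorem rescale_rescale_rootsOfUnity {m : ℕ} (ξ ω : rootsOfUnity m ℂ) (y : PowerSeries ℂ) :
    rescale ((ξ : ℂˣ) : ℂ) (rescale ((ω : ℂˣ) : ℂ) y) =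
      rescale (((ξ * ω : rootsOfUnity m ℂ) : ℂˣ) : ℂ) y := by
  rw [rescale_rescale, mul_comm ξ ω]
  rfl

theorem conjPoly_map_rescale {m : ℕ} [NeZero m] (y : PowerSeries ℂ) (ω : ℂ) (hω : ω ^ m = 1) :
    (conjPoly m y).map (rescale ω) = conjPoly m y := by
  obtain ⟨ξ, rfl⟩ := exists_rootsOfUnity_coe_eq hω
  rw [conjPoly, Polynomial.map_prod]
  refine Fintype.prod_equiv (Equiv.mulLeft ξ) _ _ fun η => ?_
  rw [Polynomial.map_sub, Polynomial.map_X, Polynomial.map_C, rescale_rescale_rootsOfUnity]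
  rfl

theorem conjPoly_monic (m : ℕ) [NeZero m] (y : PowerSeries ℂ) : (conjPoly m y).Monic :=
  Polynomial.monic_prod_of_monic _ _ fun _ _ => Polynomial.monic_X_sub_C _

/-- The polynomial over `ℂ⟦ε⟧` which becomes `conjPoly m y` for `ε = tᵐ`. -/
theorem exists_orbitPoly {m : ℕ} [NeZero m] (y : PowerSeries ℂ) :
    ∃ f : Polynomial (PowerSeries ℂ), f.Monic ∧
      f.map (expand m (NeZero.ne m) : PowerSeries ℂ →ₐ[ℂ] PowerSeries ℂ).toRingHom =
        conjPoly m y := by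
  obtain ⟨f, hf⟩ := exists_map_expand_eq (NeZero.ne m) (conjPoly_map_rescale (m := m) y)
  refine ⟨f, ?_, hf⟩
  refine Polynomial.monic_of_injective (expand_injective (NeZero.ne m)) (p := f) ?_
  exact hf ▸ conjPoly_monic m y

/-- Lagrange interpolation: the polynomial `L` that takes, up to the usual denominators, the values
`v(ωt)` at the conjugates `y(ωt)` is invariant under `t ↦ ωt`, so its coefficients are series in
`t^m`. At `y` it equals `v * D`, where `D` is the product of the differences `y - y(ηt)`, `η ≠ 1`.
Hence the ring contains `D ℂ⟦t⟧`, and `D` is a power of `t` times a unit. -/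
theorem exists_conductor {m : ℕ} [NeZero m] {y : PowerSeries ℂ}
    (hy : ∀ ω : ℂ, ω ^ m = 1 → ω ≠ 1 → rescale ω y ≠ y) :
    ∃ N : ℕ, ∀ v : PowerSeries ℂ, X ^ N ∣ v → ∃ f : Polynomial (PowerSeries ℂ),
      f.eval₂ (expand m (NeZero.ne m) : PowerSeries ℂ →ₐ[ℂ] PowerSeries ℂ).toRingHom y = v := by
  classical
  set D : PowerSeries ℂ :=
    ∏ η ∈ (Finset.univ : Finset (rootsOfUnity m ℂ)).erase 1, (y - rescale ((η : ℂˣ) : ℂ) y) with hD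
  have hD0 : D ≠ 0 := by
    refine Finset.prod_ne_zero_iff.2 fun η hη =>
      sub_ne_zero.2 (hy _ (coe_rootsOfUnity_pow η) ?_).symm
    intro h
    exact (Finset.mem_erase.1 hη).1 (Subtype.ext (Units.ext h))
  have key : ∀ v : PowerSeries ℂ, ∃ f : Polynomial (PowerSeries ℂ),
      f.eval₂ (expand m (NeZero.ne m) : PowerSeries ℂ →ₐ[ℂ] PowerSeries ℂ).toRingHom y = v * D := by
    intro v
    set L : Polynomial (PowerSeries ℂ) := ∑ ω : rootsOfUnity m ℂ,
      Polynomial.C (rescale ((ω : ℂˣ) : ℂ) v) *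
        ∏ η ∈ Finset.univ.erase ω, (Polynomial.X - Polynomial.C (rescale ((η : ℂˣ) : ℂ) y)) with hL
    obtain ⟨f, hf⟩ := exists_map_expand_eq (NeZero.ne m) (p := L) (by
      intro ω hω
      obtain ⟨ξ, rfl⟩ := exists_rootsOfUnity_coe_eq hω
      rw [hL, Polynomial.map_sum]
      refine Fintype.sum_equiv (Equiv.mulLeft ξ) _ _ fun η => ?_
      rw [Polynomial.map_mul, Polynomial.map_C, rescale_rescale_rootsOfUnity, Polynomial.map_prod]
      congr 1
      refine Finset.prod_equiv (Equiv.mulLeft ξ) (fun a => by simp) fun a _ => ?_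
      rw [Polynomial.map_sub, Polynomial.map_X, Polynomial.map_C, rescale_rescale_rootsOfUnity]
      rfl)
    refine ⟨f, ?_⟩
    rw [← Polynomial.eval_map, hf, hL, Polynomial.eval_finsetSum, Finset.sum_eq_single 1]
    · simp [Polynomial.eval_prod, hD]
    · intro ω _ hω
      rw [Polynomial.eval_mul, Polynomial.eval_prod,
        Finset.prod_eq_zero (i := 1) (by simp [hω.symm]) (by simp), mul_zero]
    · simp
  refine ⟨D.order.toNat, fun v hv => ?_⟩
  obtain ⟨g, rfl⟩ := hv
  have hu : IsUnit (divXPowOrder D) := isUnit_iff_constantCoeff.2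
    (Ne.isUnit fun h => hD0 (constantCoeff_divXPowOrder_eq_zero_iff.1 h))
  obtain ⟨u, hu⟩ := hu
  obtain ⟨f, hf⟩ := key (g * (u⁻¹ : (PowerSeries ℂ)ˣ))
  refine ⟨f, hf.trans ?_⟩
  conv_lhs => rw [← X_pow_order_mul_divXPowOrder (f := D), ← hu]
  rw [mul_comm _ (u : PowerSeries ℂ), mul_assoc, Units.inv_mul_cancel_left, mul_comm]

/-! ## Parametrized subrings -/

theorem hasSubst_pair {u v : PowerSeries ℂ} (hu : constantCoeff u = 0) (hv : constantCoeff v = 0) :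
    MvPowerSeries.HasSubst (![u, v] : Fin 2 → MvPowerSeries Unit ℂ) :=
  MvPowerSeries.hasSubst_of_constantCoeff_zero fun i => by fin_cases i <;> assumption

/-- The subalgebra of all power series in `u` and `v`. -/
noncomputable def pairRange {u v : PowerSeries ℂ} (hu : constantCoeff u = 0)
    (hv : constantCoeff v = 0) : Subalgebra ℂ (PowerSeries ℂ) :=
  (MvPowerSeries.substAlgHom (R := ℂ) (hasSubst_pair hu hv)).range

theorem subst_mem_pairRange {u v : PowerSeries ℂ} (hu : constantCoeff u = 0)
    (hv : constantCoeff v = 0) (i : Fin 2) (p : PowerSeries ℂ) :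
    (PowerSeries.subst ((![u, v] : Fin 2 → PowerSeries ℂ) i) p : PowerSeries ℂ) ∈
      pairRange hu hv := by
  refine ⟨PowerSeries.subst (MvPowerSeries.X i : MvPowerSeries (Fin 2) ℂ) p, ?_⟩
  have h1 : HasSubst (MvPowerSeries.X i : MvPowerSeries (Fin 2) ℂ) := HasSubst.X i
  have h2 := hasSubst_pair hu hv
  change MvPowerSeries.substAlgHom h2 _ = _
  rw [MvPowerSeries.substAlgHom_apply, PowerSeries.subst_def, PowerSeries.subst_def,
    MvPowerSeries.subst_comp_subst_apply h1.const h2]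
  congr 1
  funext _
  rw [MvPowerSeries.subst_X h2]

theorem mem_pairRange {u v : PowerSeries ℂ} (hu : constantCoeff u = 0)
    (hv : constantCoeff v = 0) (i : Fin 2) :
    (![u, v] : Fin 2 → PowerSeries ℂ) i ∈ pairRange hu hv := by
  have := subst_mem_pairRange hu hv i X
  rwa [subst_X] at this
  exact HasSubst.of_constantCoeff_zero' (by fin_cases i <;> assumption)

/-- A subalgebra with a conductor is closed under power series in two of its elements. -/
theorem pairRange_le {u v : PowerSeries ℂ} (hu : constantCoeff u = 0)
    (hv : constantCoeff v = 0) {B : Subalgebra ℂ (PowerSeries ℂ)} {N : ℕ}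
    (hB : ∀ f : PowerSeries ℂ, X ^ N ∣ f → f ∈ B) (huB : u ∈ B) (hvB : v ∈ B) :
    pairRange hu hv ≤ B := by
  rintro _ ⟨g, rfl⟩
  have h2 := hasSubst_pair hu hv
  -- The truncation is a polynomial in `u` and `v`, hence lies in `B`. The remainder has order at
  -- least `N` after substitution, because `u` and `v` have no constant term, and falls into the
  -- conductor.
  set gt : MvPolynomial (Fin 2) ℂ := MvPowerSeries.truncTotal N g
  change MvPowerSeries.substAlgHom h2 g ∈ B
  have h3 : (MvPowerSeries.substAlgHom h2 (gt : MvPowerSeries (Fin 2) ℂ)) ∈ B := by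
    rw [MvPowerSeries.substAlgHom_coe]
    have h5 : MvPolynomial.aeval (![u, v] : Fin 2 → PowerSeries ℂ) gt ∈
        (MvPolynomial.aeval (R := ℂ) (![u, v] : Fin 2 → PowerSeries ℂ)).range := ⟨gt, rfl⟩
    rw [MvPolynomial.aeval_range] at h5
    refine Algebra.adjoin_le ?_ h5
    rintro _ ⟨i, rfl⟩
    fin_cases i <;> assumption
  have h4 : X ^ N ∣ (MvPowerSeries.substAlgHom h2
      ((g : MvPowerSeries (Fin 2) ℂ) - (gt : MvPowerSeries (Fin 2) ℂ)) : PowerSeries ℂ) := by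
    rw [X_pow_dvd_iff]
    intro n hn
    refine coeff_of_lt_order n ?_
    rw [order_eq_order]
    have h5 : (N : ℕ∞) ≤ (g - (gt : MvPowerSeries (Fin 2) ℂ)).order := by
      refine MvPowerSeries.nat_le_order fun d hd => ?_
      rw [map_sub, MvPolynomial.coeff_coe, MvPowerSeries.coeff_truncTotal _ hd, sub_self]
    have h6 := MvPowerSeries.le_order_subst h2 (g - (gt : MvPowerSeries (Fin 2) ℂ))
    rw [MvPowerSeries.substAlgHom_apply]
    refine lt_of_lt_of_le (Nat.cast_lt.2 hn) (h5.trans (le_trans ?_ h6))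
    refine ENat.self_le_mul_left _ (Order.one_le_iff_ne_zero.1 (le_iInf fun i => ?_))
    rw [MvPowerSeries.one_le_order_iff_constCoeff_eq_zero]
    fin_cases i <;> assumption
  have h5 := B.add_mem h3 (hB _ h4)
  rw [← map_add] at h5
  simpa using h5

/-! ## Puiseux characteristics of parametrized branches -/

/-- The homomorphism `ℂ⟦ε⟧[Y] → ℂ⟦t⟧`, `ε ↦ tᵐ`, `Y ↦ y`. -/
noncomputable def branchHom (m : ℕ) [NeZero m] (y : PowerSeries ℂ) :
    Polynomial (PowerSeries ℂ) →ₐ[ℂ] PowerSeries ℂ :=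
  Polynomial.eval₂AlgHom (expand m (NeZero.ne m) : PowerSeries ℂ →ₐ[ℂ] PowerSeries ℂ) y
    fun _ => Commute.all _ _

theorem branchHom_apply (m : ℕ) [NeZero m] (y : PowerSeries ℂ) (f : Polynomial (PowerSeries ℂ)) :
    branchHom m y f =
      f.eval₂ (expand m (NeZero.ne m) : PowerSeries ℂ →ₐ[ℂ] PowerSeries ℂ).toRingHom y :=
  rfl

theorem branchHom_C (m : ℕ) [NeZero m] (y p : PowerSeries ℂ) :
    branchHom m y (Polynomial.C p) = expand m (NeZero.ne m) p := by
  rw [branchHom_apply, Polynomial.eval₂_C]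
  rfl

theorem branchHom_X (m : ℕ) [NeZero m] (y : PowerSeries ℂ) :
    branchHom m y Polynomial.X = y := by
  rw [branchHom_apply, Polynomial.eval₂_X]

theorem exists_conductor_branchHom {m : ℕ} [NeZero m] {y : PowerSeries ℂ}
    (hy : ∀ ω : ℂ, ω ^ m = 1 → ω ≠ 1 → rescale ω y ≠ y) :
    ∃ N : ℕ, ∀ v : PowerSeries ℂ, X ^ N ∣ v → v ∈ (branchHom m y).range :=
  exists_conductor hy

theorem map_range_branchHom_le {m : ℕ} [NeZero m] {y : PowerSeries ℂ}
    (ψ : PowerSeries ℂ →ₐ[ℂ] PowerSeries ℂ) {R : Subalgebra ℂ (PowerSeries ℂ)}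
    (h1 : ∀ p, ψ (expand m (NeZero.ne m) p) ∈ R) (h2 : ψ y ∈ R) :
    (branchHom m y).range.map ψ ≤ R := by
  rintro _ ⟨_, ⟨f, rfl⟩, rfl⟩
  change ψ (branchHom m y f) ∈ R
  induction f using Polynomial.induction_on' with
  | add f g hf hg =>
    rw [map_add, map_add]
    exact R.add_mem hf hg
  | monomial k p =>
    rw [← Polynomial.C_mul_X_pow_eq_monomial, map_mul, map_pow, map_mul, map_pow, branchHom_C,
      branchHom_X]
    exact R.mul_mem (h1 p) (R.pow_mem h2 k)

theorem coe_pairRange {u v : PowerSeries ℂ} (hu : constantCoeff u = 0) (hv : constantCoeff v = 0) :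
    (pairRange hu hv : Set (PowerSeries ℂ)) =
      Set.range fun g : MvPowerSeries (Fin 2) ℂ =>
        (MvPowerSeries.subst (![u, v] : Fin 2 → MvPowerSeries Unit ℂ) g : MvPowerSeries Unit ℂ) := by
  ext f
  constructor
  · rintro ⟨g, rfl⟩
    exact ⟨g, (MvPowerSeries.substAlgHom_apply (hasSubst_pair hu hv) g).symm⟩
  · rintro ⟨g, rfl⟩
    exact ⟨g, MvPowerSeries.substAlgHom_apply (hasSubst_pair hu hv) g⟩

/-- The power series without its constant term. -/
noncomputable def reduced (y : PowerSeries ℂ) : PowerSeries ℂ := y - C (constantCoeff y)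

theorem constantCoeff_reduced (y : PowerSeries ℂ) : constantCoeff (reduced y) = 0 := by
  simp [reduced]

theorem rescale_reduced_sub (ω : ℂ) (y : PowerSeries ℂ) :
    rescale ω (reduced y) - reduced y = rescale ω y - y := by
  rw [reduced, map_sub]
  have : rescale ω (C (constantCoeff y)) = C (constantCoeff y) := by
    ext n
    rw [coeff_rescale, coeff_C]
    split_ifs with h <;> simp [h]
  rw [this]
  ring

theorem reduced_mem_range_branchHom {m : ℕ} [NeZero m] (y : PowerSeries ℂ) :
    reduced y ∈ (branchHom m y).range :=
  sub_mem ⟨Polynomial.X, branchHom_X m y⟩ (Subalgebra.algebraMap_mem _ (constantCoeff y))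

theorem X_pow_mem_range_branchHom {m : ℕ} [NeZero m] (y : PowerSeries ℂ) :
    X ^ m ∈ (branchHom m y).range :=
  ⟨Polynomial.C X, (branchHom_C m y X).trans (expand_X m (NeZero.ne m))⟩

/-- If `y - y(0)` has order at least `m`, then `X = tᵐ` is a transversal parameter. -/
theorem exists_parametrization_of_le_order {m : ℕ} [NeZero m] {y : PowerSeries ℂ}
    (hy : ∀ ω : ℂ, ω ^ m = 1 → ω ≠ 1 → rescale ω y ≠ y) (h : (m : ℕ∞) ≤ (reduced y).order) :
    ∃ b : PowerSeries ℂ, (m : ℕ∞) < b.order ∧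
      ((branchHom m y).range : Set (PowerSeries ℂ)) = parametrizedSubring m b ∧
      ∀ ω : ℂ, ω ^ m = 1 → rescale ω b - b = rescale ω y - y := by
  have hX : constantCoeff ((X : PowerSeries ℂ) ^ m) = 0 := by simp [NeZero.ne m]
  -- Subtracting the `t^m` term makes the order strictly larger than `m`. It changes neither the
  -- ring, which contains `t^m`, nor the differences of conjugates.
  set c := coeff m (reduced y) with hc
  set b := reduced y - C c * X ^ m with hb
  have hb0 : constantCoeff b = 0 := by
    rw [hb, map_sub, constantCoeff_reduced, map_mul, hX, mul_zero, sub_zero]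
  have hbB : b ∈ (branchHom m y).range :=
    sub_mem (reduced_mem_range_branchHom y)
      (mul_mem (Subalgebra.algebraMap_mem _ c) (X_pow_mem_range_branchHom y))
  refine ⟨b, ?_, ?_, ?_⟩
  · refine lt_of_lt_of_le (Nat.cast_lt.2 (Nat.lt_succ_self m)) (nat_le_order _ _ fun i hi => ?_)
    rw [hb, map_sub, coeff_C_mul, coeff_X_pow]
    rcases (Nat.lt_succ_iff.1 hi).lt_or_eq with h1 | rfl
    · rw [if_neg h1.ne, mul_zero, sub_zero]
      exact coeff_of_lt_order _ ((Nat.cast_lt.2 h1).trans_le h)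
    · simp [hc]
  · obtain ⟨N, hN⟩ := exists_conductor_branchHom hy
    have h1 : (branchHom m y).range = pairRange hX hb0 := by
      refine le_antisymm ?_ (pairRange_le hX hb0 hN (X_pow_mem_range_branchHom y) hbB)
      have h2 : (branchHom m y).range.map (AlgHom.id ℂ _) ≤ pairRange hX hb0 := by
        refine map_range_branchHom_le _ (fun p => ?_) ?_
        · rw [AlgHom.id_apply, expand_apply]
          exact subst_mem_pairRange hX hb0 0 p
        · have h3 : y = b + C c * X ^ m + C (constantCoeff y) := by
            rw [hb, reduced]
            ring
          change y ∈ _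
          rw [h3]
          exact add_mem (add_mem (mem_pairRange hX hb0 1)
            (mul_mem (Subalgebra.algebraMap_mem _ c) (mem_pairRange hX hb0 0)))
            (Subalgebra.algebraMap_mem _ (constantCoeff y))
      rwa [Subalgebra.map_id] at h2
    rw [h1, coe_pairRange]
    rfl
  · intro ω hω
    rw [← rescale_reduced_sub ω y, hb, map_sub, map_mul, map_pow, rescale_X, mul_pow, ← map_pow C,
      hω]
    have : rescale ω (C c) = C c := by
      ext n
      rw [coeff_rescale, coeff_C]
      split_ifs with h <;> simp [h]
    rw [this, map_one, one_mul]
    ring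

/-- If `y - y(0)` has order `q < m`, then it is a transversal parameter, and becomes a `q`-th power
in a suitable coordinate. -/
theorem exists_parametrization_of_order_lt {m q : ℕ} [NeZero m] {y : PowerSeries ℂ}
    (hy : ∀ ω : ℂ, ω ^ m = 1 → ω ≠ 1 → rescale ω y ≠ y) (hq : (reduced y).order = q) (hqm : q < m) :
    ∃ b : PowerSeries ℂ, (q : ℕ∞) < b.order ∧
      (∃ ψ : PowerSeries ℂ →ₐ[ℂ] PowerSeries ℂ, Function.Injective ψ ∧
        ((branchHom m y).range.map ψ : Set (PowerSeries ℂ)) = parametrizedSubring q b) ∧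
      (∀ ω : ℂ, ω ^ q = 1 → ω ^ m = 1 →
        (rescale ω b - b).order + (q - 1 : ℕ) = (rescale ω y - y).order + (m - 1 : ℕ)) ∧
      ∀ ω : ℂ, ω ^ m ≠ 1 → (rescale ω b - b).order = m := by
  have hq0 : q ≠ 0 := by
    rintro rfl
    exact order_ne_zero_iff_constCoeff_eq_zero.2 (constantCoeff_reduced y) hq
  -- Write `y - y(0) = S^q` and let `T` be inverse to `S`. The substitution `t ↦ T` turns the pair
  -- `(y - y(0), t^m)` into `(t^q, T^m)`.
  obtain ⟨S, hS0, hS1, hSq⟩ := exists_parameter_pow_eq hq0 hq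
  obtain ⟨T, hST, hT1⟩ := exists_isInversePair hS0 hS1
  have hT := HasSubst.of_constantCoeff_zero' hST.right_zero
  have hS := HasSubst.of_constantCoeff_zero' hS0
  have hb0 : constantCoeff (T ^ m) = 0 := by simp [hST.right_zero, NeZero.ne m]
  have hX0 : constantCoeff ((X : PowerSeries ℂ) ^ q) = 0 := by simp [hq0]
  have hψX : ∀ n, substAlgHom (R := ℂ) hT ((X : PowerSeries ℂ) ^ n) = T ^ n := fun n => by
    rw [map_pow, coe_substAlgHom, subst_X hT]
  have hψy : substAlgHom (R := ℂ) hT (reduced y) = (X : PowerSeries ℂ) ^ q := by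
    rw [← hSq, map_pow, coe_substAlgHom, hST.subst_right]
  have hψψ : ∀ f : PowerSeries ℂ, substAlgHom (R := ℂ) hT (substAlgHom (R := ℂ) hS f) = f := by
    intro f
    rw [coe_substAlgHom, coe_substAlgHom, subst_comp_subst_apply hS hT, hST.subst_right]
    exact X_subst f
  have hψψ' : ∀ f : PowerSeries ℂ, substAlgHom (R := ℂ) hS (substAlgHom (R := ℂ) hT f) = f := by
    intro f
    rw [coe_substAlgHom, coe_substAlgHom, subst_comp_subst_apply hT hS, hST.subst_left]
    exact X_subst f
  refine ⟨T ^ m, ?_, ⟨substAlgHom hT, Function.LeftInverse.injective hψψ', ?_⟩, ?_, ?_⟩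
  · obtain ⟨t, rfl, ht⟩ := exists_eq_X_mul hST.right_zero
    rw [order_eq_nat_of_eq_X_pow_mul (mul_pow X t m)
      (by rw [map_pow]; exact pow_ne_zero _ (ht.trans_ne hT1))]
    exact Nat.cast_lt.2 hqm
  · obtain ⟨N, hN⟩ := exists_conductor_branchHom hy
    have h1 : (branchHom m y).range.map (substAlgHom hT) = pairRange hX0 hb0 := by
      refine le_antisymm ?_ (pairRange_le hX0 hb0 (N := N) (fun f hf => ?_) ?_ ?_)
      · refine map_range_branchHom_le _ (fun p => ?_) ?_
        · have h2 := subst_mem_pairRange hX0 hb0 1 p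
          rw [expand_apply, coe_substAlgHom,
            subst_comp_subst_apply (HasSubst.X_pow (NeZero.ne m)) hT, ← coe_substAlgHom hT, hψX]
          exact h2
        · have h3 : y = reduced y + algebraMap ℂ (PowerSeries ℂ) (constantCoeff y) := by
            change y = reduced y + C (constantCoeff y)
            rw [reduced]
            ring
          rw [h3, map_add, hψy, AlgHom.commutes]
          exact add_mem (mem_pairRange hX0 hb0 0) (Subalgebra.algebraMap_mem _ _)
      -- The conductor survives the change of coordinate: if `t^N` divides `f`, then it divides
      -- `f(S)`, since `S` has no constant term.
      · refine ⟨substAlgHom (R := ℂ) hS f, hN _ ?_, hψψ f⟩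
        obtain ⟨g, rfl⟩ := hf
        rw [map_mul, map_pow, coe_substAlgHom, subst_X hS]
        exact Dvd.dvd.mul_right (pow_dvd_pow_of_dvd (X_dvd_iff.2 hS0) N) _
      · exact ⟨reduced y, reduced_mem_range_branchHom y, hψy⟩
      · exact ⟨X ^ m, X_pow_mem_range_branchHom y, hψX m⟩
    rw [h1, coe_pairRange]
    rfl
  · intro ω h1 h2
    rw [hST.order_rescale_pow_add hS1 hT1 hq0 (NeZero.ne m) h1 h2, hSq, rescale_reduced_sub]
  · intro ω h1
    exact order_rescale_pow_sub_of_pow_ne_one hST.right_zero hT1 h1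

/-- For a primitive `m`-th root of unity `ω` and `0 < j < m`, the factor `ω^j - 1` is nonzero. Below
degree `m`, the series `y(ωt) - y(t)` and `y - y(0)` thus have the same nonzero exponents, so the
orders see whether `q < m`, and the value of `q`. -/
theorem order_reduced_eq_of_order_rescale_eq {m q : ℕ} [NeZero m] {y y' : PowerSeries ℂ}
    (h : ∀ ω : ℂ, ω ^ m = 1 → (rescale ω y - y).order = (rescale ω y' - y').order)
    (hq : (reduced y).order = q) (hqm : q < m) : (reduced y').order = q := by
  have hω := Complex.isPrimitiveRoot_exp m (NeZero.ne m)
  set ω := Complex.exp (2 * Real.pi * Complex.I / m)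
  have key : ∀ (z : PowerSeries ℂ) (j : ℕ), j < m →
      (coeff j (rescale ω z - z) = 0 ↔ coeff j (reduced z) = 0) := by
    intro z j hj
    rcases Nat.eq_zero_or_pos j with rfl | hj0
    · simp [constantCoeff_reduced, rescale_constantCoeff]
    · rw [← rescale_reduced_sub, map_sub, coeff_rescale, ← sub_one_mul, mul_eq_zero, sub_eq_zero,
        hω.pow_eq_one_iff_dvd, or_iff_right (Nat.not_dvd_of_pos_of_lt hj0 hj)]
  rw [order_eq_nat] at hq
  have h1 : (rescale ω y - y).order = q :=
    order_eq_nat.2 ⟨fun h0 => hq.1 ((key y q hqm).1 h0),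
      fun i hi => (key y i (hi.trans hqm)).2 (hq.2 i hi)⟩
  rw [h ω hω.pow_eq_one, order_eq_nat] at h1
  exact order_eq_nat.2 ⟨fun h0 => h1.1 ((key y' q hqm).2 h0),
    fun i hi => (key y' i (hi.trans hqm)).1 (h1.2 i hi)⟩

theorem hasPuiseuxCharacteristic_of_map_range_eq {A : Type*} [CommRing A] [Algebra ℂ A]
    (Φ : A →ₐ[ℂ] PowerSeries ℂ) {P : Ideal A} (hP : RingHom.ker Φ = P) {n : ℕ} {b : PowerSeries ℂ}
    (hn : n ≠ 0) (hb : (n : ℕ∞) < b.order) (ψ : PowerSeries ℂ →ₐ[ℂ] PowerSeries ℂ)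
    (hψ : Function.Injective ψ)
    (h : (Φ.range.map ψ : Set (PowerSeries ℂ)) = parametrizedSubring n b) {l : List ℕ}
    (hl : IsCharacteristicTail b n l) : HasPuiseuxCharacteristic (A ⧸ P) (n :: l) := by
  subst hP
  refine ⟨n, b, l, ⟨Nat.pos_of_ne_zero hn, hb, ψ.comp (Ideal.kerLiftAlg Φ),
    hψ.comp (Ideal.kerLiftAlg_injective Φ), ?_⟩, hl, rfl⟩
  rw [← h]
  ext f
  constructor
  · rintro ⟨a, rfl⟩
    obtain ⟨a, rfl⟩ := Ideal.Quotient.mk_surjective a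
    exact ⟨Φ a, ⟨a, rfl⟩, rfl⟩
  · rintro ⟨_, ⟨a, rfl⟩, rfl⟩
    exact ⟨Ideal.Quotient.mk _ a, rfl⟩

/-- The orders of the differences of the conjugates determine the Puiseux characteristic. -/
theorem samePuiseuxCharacteristic_of_order_rescale_eq {A A' : Type*} [CommRing A] [Algebra ℂ A]
    [CommRing A'] [Algebra ℂ A'] {m : ℕ} [NeZero m] {y y' : PowerSeries ℂ}
    (hy : ∀ ω : ℂ, ω ^ m = 1 → ω ≠ 1 → rescale ω y ≠ y)
    (h : ∀ ω : ℂ, ω ^ m = 1 → (rescale ω y - y).order = (rescale ω y' - y').order)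
    (Φ : A →ₐ[ℂ] PowerSeries ℂ) (hΦ : Φ.range = (branchHom m y).range)
    {P : Ideal A} (hP : RingHom.ker Φ = P)
    (Φ' : A' →ₐ[ℂ] PowerSeries ℂ) (hΦ' : Φ'.range = (branchHom m y').range)
    {P' : Ideal A'} (hP' : RingHom.ker Φ' = P') :
    SamePuiseuxCharacteristic (A ⧸ P) (A' ⧸ P') := by
  have hy' : ∀ ω : ℂ, ω ^ m = 1 → ω ≠ 1 → rescale ω y' ≠ y' := by
    intro ω h1 h2 h3
    have h4 := h ω h1
    rw [sub_eq_zero.2 h3, order_zero, order_eq_top, sub_eq_zero] at h4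
    exact hy ω h1 h2 h4
  by_cases hm : (m : ℕ∞) ≤ (reduced y).order
  · have hm' : (m : ℕ∞) ≤ (reduced y').order := by
      by_contra hc
      rw [not_le] at hc
      obtain ⟨q, hq⟩ := ENat.ne_top_iff_exists.1 hc.ne_top
      rw [← hq] at hc
      have h1 := order_reduced_eq_of_order_rescale_eq (fun ω hω => (h ω hω).symm) hq.symm
        (Nat.cast_lt.1 hc)
      exact absurd (h1 ▸ hm) (not_le.2 hc)
    obtain ⟨b, hb, hbr, hbω⟩ := exists_parametrization_of_le_order hy hm
    obtain ⟨b', hb', hbr', hbω'⟩ := exists_parametrization_of_le_order hy' hm'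
    obtain ⟨l, hl⟩ := exists_isCharacteristicTail (b := b) (NeZero.ne m) fun ω h1 h2 h3 => by
      have h4 := hbω ω h1
      rw [sub_eq_zero.2 h3] at h4
      exact hy ω h1 h2 (sub_eq_zero.1 h4.symm)
    have hl' : IsCharacteristicTail b' m l := hl.congr (NeZero.ne m)
      (fun ω hω => by rw [hbω ω hω, hbω' ω hω, h ω hω]) dvd_rfl
    refine ⟨m :: l, ?_, ?_⟩
    · refine hasPuiseuxCharacteristic_of_map_range_eq Φ hP (NeZero.ne m) hb (AlgHom.id ℂ _)
        Function.injective_id ?_ hl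
      rw [Subalgebra.map_id, hΦ, hbr]
    · refine hasPuiseuxCharacteristic_of_map_range_eq Φ' hP' (NeZero.ne m) hb' (AlgHom.id ℂ _)
        Function.injective_id ?_ hl'
      rw [Subalgebra.map_id, hΦ', hbr']
  · rw [not_le] at hm
    obtain ⟨q, hq⟩ := ENat.ne_top_iff_exists.1 hm.ne_top
    rw [← hq] at hm
    have hqm := Nat.cast_lt.1 hm
    have hq0 : q ≠ 0 := by
      rintro rfl
      exact order_ne_zero_iff_constCoeff_eq_zero.2 (constantCoeff_reduced y) hq.symm
    have hq' := order_reduced_eq_of_order_rescale_eq h hq.symm hqm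
    obtain ⟨b, hb, ⟨ψ, hψ, hbr⟩, hbω, hbm⟩ := exists_parametrization_of_order_lt hy hq.symm hqm
    obtain ⟨b', hb', ⟨ψ', hψ', hbr'⟩, hbω', hbm'⟩ := exists_parametrization_of_order_lt hy' hq' hqm
    -- A root of unity `ω ≠ 1` with `ω^q = 1` cannot fix `b`: if `ω^m = 1`, the inversion formula
    -- would make it fix `y`; otherwise `b(ωt) - b(t)` has the finite order `m`.
    obtain ⟨l, hl⟩ := exists_isCharacteristicTail (b := b) hq0 fun ω h1 h2 h3 => by
      rw [← sub_eq_zero, ← order_eq_top] at h3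
      by_cases hωm : ω ^ m = 1
      · have h4 := hbω ω h1 hωm
        rw [h3, top_add] at h4
        have h5 := (ENat.add_eq_top.1 h4.symm).resolve_right (ENat.natCast_ne_top _)
        exact hy ω hωm h2 (sub_eq_zero.1 (order_eq_top.1 h5))
      · rw [hbm ω hωm] at h3
        exact ENat.natCast_ne_top _ h3
    have hl' : IsCharacteristicTail b' q l := hl.congr hq0
      (fun ω hω => by
        by_cases hωm : ω ^ m = 1
        · refine (ENat.add_left_injective_of_ne_top (ENat.natCast_ne_top (q - 1))) ?_
          change _ + ((q - 1 : ℕ) : ℕ∞) = _ + ((q - 1 : ℕ) : ℕ∞)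
          rw [hbω ω hω hωm, hbω' ω hω hωm, h ω hωm]
        · rw [hbm ω hωm, hbm' ω hωm]) dvd_rfl
    refine ⟨q :: l, ?_, ?_⟩
    · refine hasPuiseuxCharacteristic_of_map_range_eq Φ hP hq0 hb ψ hψ ?_ hl
      rw [hΦ, hbr]
    · refine hasPuiseuxCharacteristic_of_map_range_eq Φ' hP' hq0 hb' ψ' hψ' ?_ hl'
      rw [hΦ', hbr']

/-! ## Intersection numbers -/

/-- The quotient is a quotient of the space of truncations in degrees below `N`. -/
theorem length_quotient_ne_top_of_conductor {B : Submodule ℂ (PowerSeries ℂ)} {N : ℕ}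
    (hB : ∀ f : PowerSeries ℂ, X ^ N ∣ f → f ∈ B) : Module.length ℂ (PowerSeries ℂ ⧸ B) ≠ ⊤ := by
  set T : PowerSeries ℂ →ₗ[ℂ] (Fin N → ℂ) := LinearMap.pi fun i => coeff (i : ℕ)
  have hT : LinearMap.ker T ≤ B := by
    intro f hf
    refine hB f (X_pow_dvd_iff.2 fun n hn => ?_)
    exact congrFun (LinearMap.mem_ker.1 hf) ⟨n, hn⟩
  have h1 := Module.length_le_of_injective _ (LinearMap.ker_eq_bot.1
    ((LinearMap.ker T).ker_liftQ_eq_bot T le_rfl le_rfl))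
  have h2 := Module.length_le_of_surjective _ (Submodule.factor_surjective hT)
  exact ne_top_of_le_ne_top Module.length_ne_top (h2.trans h1)

theorem mapQ_injective {M N : Type*} [AddCommGroup M] [AddCommGroup N] [Module ℂ M] [Module ℂ N]
    {p : Submodule ℂ M} {q : Submodule ℂ N} {f : M →ₗ[ℂ] N} (h : p ≤ q.comap f)
    (h' : q.comap f ≤ p) : Function.Injective (p.mapQ q f h) := by
  rw [injective_iff_map_eq_zero]
  intro z hz
  obtain ⟨c, rfl⟩ := Submodule.Quotient.mk_surjective _ z
  rw [Submodule.mapQ_apply, Submodule.Quotient.mk_eq_zero] at hz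
  exact (Submodule.Quotient.mk_eq_zero _).2 (h' hz)

theorem mapQ_exact_factor {M N : Type*} [AddCommGroup M] [AddCommGroup N] [Module ℂ M] [Module ℂ N]
    {p : Submodule ℂ M} {q r : Submodule ℂ N} {f : M →ₗ[ℂ] N} (h : p ≤ q.comap f)
    (hqr : q ≤ r) (hr : r = LinearMap.range f) :
    Function.Exact (p.mapQ q f h) (Submodule.factor hqr) := by
  intro z
  obtain ⟨c, rfl⟩ := Submodule.Quotient.mk_surjective _ z
  rw [← Submodule.mkQ_apply, Submodule.factor_mk, Submodule.mkQ_apply,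
    Submodule.Quotient.mk_eq_zero]
  constructor
  · intro hc
    rw [hr] at hc
    obtain ⟨b, rfl⟩ := hc
    exact ⟨Submodule.Quotient.mk b, Submodule.mapQ_apply _ _ _ _⟩
  · rintro ⟨b, hb⟩
    obtain ⟨b, rfl⟩ := Submodule.Quotient.mk_surjective _ b
    rw [Submodule.mapQ_apply, Submodule.mkQ_apply, Submodule.Quotient.eq] at hb
    have h2 : f b ∈ r := hr ▸ ⟨b, rfl⟩
    have h3 := r.sub_mem h2 (hqr hb)
    rwa [sub_sub_cancel] at h3

/-- If the subring `range Φ` of `ℂ⟦t⟧` has a conductor, the intersection number of its branch with a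
principal branch is computed in `ℂ⟦t⟧`. -/
theorem intersectionNumber_eq_length {A : Type*} [CommRing A] [Algebra ℂ A]
    (Φ : A →ₐ[ℂ] PowerSeries ℂ) {N : ℕ} (hN : ∀ f : PowerSeries ℂ, X ^ N ∣ f → f ∈ Φ.range)
    {P Q : Ideal A} (hP : RingHom.ker Φ = P) {a : A} (hQ : Q = Ideal.span {a}) (ha : Φ a ≠ 0) :
    intersectionNumber P Q =
      Module.length ℂ (PowerSeries ℂ ⧸ (Ideal.span {Φ a}).restrictScalars ℂ) := by
  set g := Φ a with hg
  set B : Submodule ℂ (PowerSeries ℂ) := LinearMap.range Φ.toLinearMap with hB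
  set G : Submodule ℂ (PowerSeries ℂ) := B.map (LinearMap.mulLeft ℂ g) with hG
  set W : Submodule ℂ (PowerSeries ℂ) := (Ideal.span {g}).restrictScalars ℂ with hW
  have hfin : Module.length ℂ (PowerSeries ℂ ⧸ B) ≠ ⊤ := length_quotient_ne_top_of_conductor hN
  have hGB : G ≤ B := by
    rintro _ ⟨_, ⟨b, rfl⟩, rfl⟩
    exact ⟨a * b, by simp [hg]⟩
  have hGW : G ≤ W := by
    rintro _ ⟨b, _, rfl⟩
    exact Ideal.mem_span_singleton.2 ⟨b, rfl⟩
  have hBG : B ≤ G.comap (LinearMap.mulLeft ℂ g) := Submodule.le_comap_map _ _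
  -- This identifies `A ⧸ (P ⊔ Q)` with `B / gB`, where `B` is the image of `Φ`.
  have hker : ∀ c : A, Φ c ∈ G ↔ c ∈ P ⊔ Q := by
    intro c
    rw [hQ, ← hP, sup_comm, Ideal.mem_span_singleton_sup]
    constructor
    · rintro ⟨_, ⟨b, rfl⟩, hb⟩
      refine ⟨b, c - b * a, ?_, by ring⟩
      rw [RingHom.mem_ker, map_sub, map_mul, ← hb]
      simp [hg, mul_comm]
    · rintro ⟨b, k, hk, rfl⟩
      rw [RingHom.mem_ker] at hk
      refine ⟨Φ b, ⟨b, rfl⟩, ?_⟩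
      rw [map_add, hk, map_mul, add_zero, mul_comm]
      rfl
  -- The length of `ℂ⟦t⟧ / gB` is computed along `gB ⊆ B` and along `gB ⊆ gℂ⟦t⟧`. Multiplication by
  -- `g` identifies `gℂ⟦t⟧ / gB` with `ℂ⟦t⟧ / B`, so the finite length of `ℂ⟦t⟧ / B` occurs on both
  -- sides and cancels.
  have e1 : Module.length ℂ (PowerSeries ℂ ⧸ G) =
      intersectionNumber P Q + Module.length ℂ (PowerSeries ℂ ⧸ B) := by
    rw [Module.length_eq_add_of_exact
      (Submodule.mapQ ((P ⊔ Q).restrictScalars ℂ) G Φ.toLinearMap fun c hc => (hker c).2 hc)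
      (Submodule.factor hGB) (mapQ_injective _ fun c hc => (hker c).1 hc)
      (Submodule.factor_surjective hGB) (mapQ_exact_factor _ hGB rfl)]
    rfl
  have e2 : Module.length ℂ (PowerSeries ℂ ⧸ G) =
      Module.length ℂ (PowerSeries ℂ ⧸ B) + Module.length ℂ (PowerSeries ℂ ⧸ W) := by
    refine Module.length_eq_add_of_exact (Submodule.mapQ B G (LinearMap.mulLeft ℂ g) hBG)
      (Submodule.factor hGW) (mapQ_injective _ ?_) (Submodule.factor_surjective hGW)
      (mapQ_exact_factor _ hGW ?_)
    · rintro c ⟨b, hb, hbc⟩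
      rwa [← mul_left_cancel₀ ha hbc]
    · ext f
      rw [hW, Submodule.restrictScalars_mem, Ideal.mem_span_singleton]
      exact exists_congr fun c => eq_comm
  rw [e1, add_comm] at e2
  exact ENat.add_right_injective_of_ne_top hfin e2

theorem span_singleton_eq_of_order_eq {f g : PowerSeries ℂ} (h : f.order = g.order) :
    Ideal.span {f} = Ideal.span {g} := by
  have key : ∀ f : PowerSeries ℂ, f ≠ 0 → Ideal.span {f} = Ideal.span {X ^ f.order.toNat} := by
    intro f hf
    rw [Ideal.span_singleton_eq_span_singleton]
    have hu : IsUnit (divXPowOrder f) := isUnit_iff_constantCoeff.2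
      (Ne.isUnit fun h => hf (constantCoeff_divXPowOrder_eq_zero_iff.1 h))
    conv_lhs => rw [← X_pow_order_mul_divXPowOrder (f := f)]
    exact (associated_mul_unit_left _ _ hu)
  by_cases hf : f = 0
  · rw [hf, order_zero, eq_comm, order_eq_top] at h
    rw [hf, h]
  · have hg : g ≠ 0 := fun hg => hf (order_eq_top.1 (h.trans (order_eq_top.2 hg)))
    rw [key f hf, key g hg, h]

/-! ## Power series in `ε^{1/m}` -/

/-- The embedding `ℂ⟦t⟧ → HahnSeries ℚ ℂ`, `t ↦ ε^{1/m}`. -/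
noncomputable def rootSeries (m : ℕ) [NeZero m] : PowerSeries ℂ →+* HahnSeries ℚ ℂ :=
  (rootEmbedding ⟨m, NeZero.pos m⟩).comp (HahnSeries.ofPowerSeries ℤ ℂ)

theorem rootEmbedding_coeff (n : ℕ+) (z : F) (k : ℤ) :
    (rootEmbedding n z).coeff (k / n) = z.coeff k := by
  rw [div_eq_mul_inv]
  exact HahnSeries.embDomain_coeff

theorem rootEmbedding_coeff_of_ne (n : ℕ+) (z : F) {q : ℚ} (hq : ∀ k : ℤ, (k / n : ℚ) ≠ q) :
    (rootEmbedding n z).coeff q = 0 := by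
  refine HahnSeries.embDomain_of_notMem_range ?_
  rintro ⟨k, hk⟩
  exact hq k (by rw [div_eq_mul_inv]; exact hk)

theorem ofPowerSeries_coeff_of_ne {Γ : Type*} [Semiring Γ] [PartialOrder Γ] [IsStrictOrderedRing Γ]
    (f : PowerSeries ℂ) {q : Γ} (hq : ∀ k : ℕ, (k : Γ) ≠ q) :
    (HahnSeries.ofPowerSeries Γ ℂ f).coeff q = 0 := by
  rw [HahnSeries.ofPowerSeries_apply]
  refine HahnSeries.embDomain_of_notMem_range ?_
  rintro ⟨k, hk⟩
  exact hq k hk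

theorem rootSeries_coeff (m : ℕ) [NeZero m] (f : PowerSeries ℂ) (k : ℕ) :
    (rootSeries m f).coeff (k / m) = coeff k f := by
  have h := rootEmbedding_coeff ⟨m, NeZero.pos m⟩ (HahnSeries.ofPowerSeries ℤ ℂ f) k
  rw [HahnSeries.ofPowerSeries_apply_coeff] at h
  rw [← h]
  rfl

theorem rootSeries_coeff_of_ne (m : ℕ) [NeZero m] (f : PowerSeries ℂ) {q : ℚ}
    (hq : ∀ k : ℕ, (k / m : ℚ) ≠ q) : (rootSeries m f).coeff q = 0 := by
  by_cases h : ∃ k : ℤ, (k / (⟨m, NeZero.pos m⟩ : ℕ+) : ℚ) = q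
  · obtain ⟨k, rfl⟩ := h
    refine (rootEmbedding_coeff _ _ k).trans (ofPowerSeries_coeff_of_ne f ?_)
    rintro j rfl
    exact hq j (by simp)
  · exact rootEmbedding_coeff_of_ne _ _ (not_exists.1 h)

theorem rootSeries_injective (m : ℕ) [NeZero m] : Function.Injective (rootSeries m) := by
  intro f g h
  ext k
  rw [← rootSeries_coeff m, h, rootSeries_coeff]

theorem rootSeries_expand (m : ℕ) [NeZero m] (f : PowerSeries ℂ) :
    rootSeries m (expand m (NeZero.ne m) f) = HahnSeries.ofPowerSeries ℚ ℂ f := by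
  have hm : (m : ℚ) ≠ 0 := Nat.cast_ne_zero.2 (NeZero.ne m)
  ext q
  by_cases hq : ∃ k : ℕ, (k : ℚ) = q
  · obtain ⟨k, rfl⟩ := hq
    rw [HahnSeries.ofPowerSeries_apply_coeff, ← coeff_expand_mul m (NeZero.ne m),
      ← rootSeries_coeff m]
    congr 1
    push_cast
    field_simp
  · rw [ofPowerSeries_coeff_of_ne f (not_exists.1 hq)]
    by_cases h : ∃ k : ℕ, (k / m : ℚ) = q
    · obtain ⟨k, rfl⟩ := h
      rw [rootSeries_coeff, coeff_expand_of_not_dvd]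
      rintro ⟨j, rfl⟩
      exact hq ⟨j, by push_cast; field_simp⟩
    · exact rootSeries_coeff_of_ne m _ (not_exists.1 h)

theorem rootSeries_order (m : ℕ) [NeZero m] {f : PowerSeries ℂ} (hf : f ≠ 0) :
    (rootSeries m f).order = f.order.toNat / m := by
  have hm : (0 : ℚ) < m := Nat.cast_pos.2 (NeZero.pos m)
  have h0 : rootSeries m f ≠ 0 := (map_ne_zero_iff _ (rootSeries_injective m)).2 hf
  refine le_antisymm (HahnSeries.order_le_of_coeff_ne_zero ?_)
    ((HahnSeries.le_order_iff_forall h0).2 fun q hq => ?_)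
  · rw [rootSeries_coeff]
    exact coeff_order hf
  · by_cases h : ∃ k : ℕ, (k / m : ℚ) = q
    · obtain ⟨k, rfl⟩ := h
      rw [rootSeries_coeff]
      refine coeff_of_lt_order_toNat k ?_
      rw [div_lt_div_iff_of_pos_right hm] at hq
      exact_mod_cast hq
    · exact rootSeries_coeff_of_ne m _ (not_exists.1 h)

/-- `tau` is defined through exponents in lowest terms. Compatibility of the roots allows any
denominator `m`: cancelling a common factor `c` replaces `ζ m ^ c` by the root for the reduced
denominator. -/
theorem IsCompatibleRoots.zpow_eq {ζ : ℕ → ℂ} (hζ : IsCompatibleRoots ζ) {m : ℕ} (hm : 0 < m)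
    (k : ℕ) : ζ ((k / m : ℚ)).den ^ ((k / m : ℚ)).num = ζ m ^ k := by
  set q : ℚ := k / m with hq
  have hm' : (m : ℚ) ≠ 0 := Nat.cast_ne_zero.2 hm.ne'
  have hden : q.den ∣ m := by
    have h := Rat.den_dvd k m
    rw [Rat.divInt_eq_div, Int.cast_natCast, Int.cast_natCast] at h
    exact Int.natCast_dvd_natCast.1 h
  obtain ⟨c, hc⟩ := hden
  have hc0 : 0 < c := Nat.pos_of_ne_zero (by rintro rfl; omega)
  have h1 : ζ q.den = ζ m ^ c := by
    rw [hc, mul_comm, hζ.2 c q.den hc0 q.den_pos]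
  have h2 : (k : ℤ) = c * q.num := by
    have h3 : (k : ℚ) = c * q.num := by
      have h4 : (k : ℚ) = q * m := by rw [hq]; field_simp
      have h5 : (m : ℚ) = q.den * c := by exact_mod_cast hc
      rw [h4, h5, ← mul_assoc, Rat.mul_den_eq_num, mul_comm]
    exact_mod_cast h3
  rw [h1, ← zpow_natCast (ζ m) c, ← zpow_mul, ← h2, zpow_natCast]

theorem tau_rootSeries {ζ : ℕ → ℂ} (hζ : IsCompatibleRoots ζ) (m : ℕ) [NeZero m]
    (f : PowerSeries ℂ) : tau ζ (rootSeries m f) = rootSeries m (rescale (ζ m) f) := by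
  ext q
  change ζ q.den ^ q.num * (rootSeries m f).coeff q = _
  by_cases h : ∃ k : ℕ, (k / m : ℚ) = q
  · obtain ⟨k, rfl⟩ := h
    rw [rootSeries_coeff, rootSeries_coeff, coeff_rescale, hζ.zpow_eq (NeZero.pos m)]
  · rw [rootSeries_coeff_of_ne m _ (not_exists.1 h), rootSeries_coeff_of_ne m _ (not_exists.1 h),
      mul_zero]

theorem tau_iterate_coeff (ζ : ℕ → ℂ) (x : HahnSeries ℚ ℂ) (m : ℕ) (q : ℚ) :
    ((tau ζ)^[m] x).coeff q = (ζ q.den ^ q.num) ^ m * x.coeff q := by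
  induction m with
  | zero => simp
  | succ m ih =>
    rw [Function.iterate_succ_apply', pow_succ', mul_assoc, ← ih]
    rfl

theorem exists_rootEmbedding_eq {ζ : ℕ → ℂ} (hζ : IsCompatibleRoots ζ) (m : ℕ+)
    {x : HahnSeries ℚ ℂ} (hx : (tau ζ)^[m] x = x) : ∃ z : F, rootEmbedding m z = x := by
  have hm : (0 : ℚ) < m := Nat.cast_pos.2 m.pos
  refine ⟨⟨fun k => x.coeff (k / m), ?_⟩, ?_⟩
  · intro f
    obtain ⟨a, b, hab, h⟩ := x.isPWO_support fun n => ⟨((f n).1 / m : ℚ), (f n).2⟩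
    refine ⟨a, b, hab, ?_⟩
    exact_mod_cast (div_le_div_iff_of_pos_right hm).1 h
  · ext q
    by_cases h : ∃ k : ℤ, (k / m : ℚ) = q
    · obtain ⟨k, rfl⟩ := h
      rw [rootEmbedding_coeff]
    · rw [rootEmbedding_coeff_of_ne _ _ (not_exists.1 h)]
      by_contra hq
      have h1 := tau_iterate_coeff ζ x m q
      rw [hx] at h1
      -- A nonzero coefficient at `a/b`, in lowest terms, must be fixed by `τ^m`. So `b` divides
      -- `am`, hence `m`.
      have h2 : (ζ q.den ^ q.num) ^ (m : ℕ) = 1 :=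
        (mul_right_cancel₀ (Ne.symm hq) ((one_mul _).trans h1)).symm
      rw [← zpow_natCast, ← zpow_mul, (hζ.1 q.den q.den_pos).zpow_eq_one_iff_dvd] at h2
      have h3 : (q.den : ℤ) ∣ (m : ℕ) := by
        refine IsCoprime.dvd_of_dvd_mul_left ?_ h2
        rw [Int.isCoprime_iff_gcd_eq_one]
        simpa [Int.gcd, Nat.coprime_comm] using q.reduced
      obtain ⟨c, hc⟩ := h3
      refine h ⟨q.num * c, ?_⟩
      have hc' : (m : ℚ) = q.den * c := by exact_mod_cast hc
      rw [div_eq_iff hm.ne', hc', ← mul_assoc, Rat.mul_den_eq_num]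
      push_cast
      rfl

/-- Invariance under `τ^m` puts `x` in `ℂ((ε^{1/m}))`. The monic equation makes it integral over
`ℂ⟦ε^{1/m}⟧`, which is integrally closed, so no negative exponents occur. -/
theorem exists_rootSeries_eq {ζ : ℕ → ℂ} (hζ : IsCompatibleRoots ζ) (m : ℕ) [NeZero m]
    {x : HahnSeries ℚ ℂ} (hx : (tau ζ)^[m] x = x) {f : Polynomial O} (hf : f.Monic)
    (hfx : f.eval₂ (HahnSeries.ofPowerSeries ℚ ℂ) x = 0) : ∃ y, rootSeries m y = x := by
  obtain ⟨z, rfl⟩ := exists_rootEmbedding_eq hζ ⟨m, NeZero.pos m⟩ hx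
  have hint : IsIntegral (PowerSeries ℂ) z := by
    refine ⟨f.map (expand m (NeZero.ne m) : PowerSeries ℂ →ₐ[ℂ] PowerSeries ℂ).toRingHom,
      hf.map _, ?_⟩
    refine (rootEmbedding ⟨m, NeZero.pos m⟩).injective ?_
    rw [Polynomial.eval₂_map, Polynomial.hom_eval₂, map_zero, ← hfx]
    congr 1
    ext1 a
    exact rootSeries_expand m a
  obtain ⟨y, rfl⟩ := IsIntegrallyClosed.isIntegral_iff.1 hint
  exact ⟨y, rfl⟩

/-! ## Orbit polynomials -/

theorem rescale_branchHom {m : ℕ} [NeZero m] {ω : ℂ} (hω : ω ^ m = 1) (y : PowerSeries ℂ)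
    (f : Polynomial (PowerSeries ℂ)) :
    rescale ω (branchHom m y f) = branchHom m (rescale ω y) f := by
  rw [branchHom_apply, Polynomial.hom_eval₂, branchHom_apply]
  congr 1
  ext1 a
  exact rescale_expand (NeZero.ne m) hω a

theorem branchHom_orbitPoly {m : ℕ} [NeZero m] {y : PowerSeries ℂ}
    {f : Polynomial (PowerSeries ℂ)}
    (hf : f.map (expand m (NeZero.ne m) : PowerSeries ℂ →ₐ[ℂ] PowerSeries ℂ).toRingHom =
      conjPoly m y) : branchHom m y f = 0 := by
  rw [branchHom_apply, ← Polynomial.eval_map, hf, conjPoly, Polynomial.eval_prod]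
  exact Finset.prod_eq_zero (Finset.mem_univ 1) (by simp)

/-- The remainder of `g` modulo `f` vanishes at `y`, hence at its `m` distinct conjugates, but has
degree less than `m`. -/
theorem orbitPoly_dvd {m : ℕ} [NeZero m] {y : PowerSeries ℂ}
    (hy : ∀ ω : ℂ, ω ^ m = 1 → ω ≠ 1 → rescale ω y ≠ y) {f g : Polynomial (PowerSeries ℂ)}
    (hf : f.map (expand m (NeZero.ne m) : PowerSeries ℂ →ₐ[ℂ] PowerSeries ℂ).toRingHom =
      conjPoly m y) (hfm : f.Monic) (hg : branchHom m y g = 0) : f ∣ g := by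
  have hinj := expand_injective (NeZero.ne m)
  rw [← Polynomial.modByMonic_eq_zero_iff_dvd hfm]
  refine Polynomial.map_injective
    (expand m (NeZero.ne m) : PowerSeries ℂ →ₐ[ℂ] PowerSeries ℂ).toRingHom hinj ?_
  rw [Polynomial.map_zero]
  have hr : branchHom m y (g %ₘ f) = 0 := by
    rw [Polynomial.modByMonic_eq_sub_mul_div g f, map_sub, map_mul, hg,
      branchHom_orbitPoly hf, zero_mul, sub_zero]
  refine Polynomial.eq_zero_of_natDegree_lt_card_of_eval_eq_zero _
    (f := fun ω : rootsOfUnity m ℂ => rescale ((ω : ℂˣ) : ℂ) y) ?_ (fun ω => ?_) ?_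
  · intro ω ξ h
    have h1 : rescale (((ξ⁻¹ * ω : rootsOfUnity m ℂ) : ℂˣ) : ℂ) y = y := by
      rw [← rescale_rescale_rootsOfUnity]
      rw [show rescale ((ω : ℂˣ) : ℂ) y = rescale ((ξ : ℂˣ) : ℂ) y from h,
        rescale_rescale_rootsOfUnity, inv_mul_cancel]
      simp
    by_contra hne
    refine hy _ (coe_rootsOfUnity_pow (ξ⁻¹ * ω)) (fun h2 => hne ?_) h1
    have h3 : ξ⁻¹ * ω = 1 := Subtype.ext (Units.ext h2)
    exact (inv_mul_eq_one.1 h3).symm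
  · rw [Polynomial.eval_map, ← branchHom_apply, ← rescale_branchHom (coe_rootsOfUnity_pow ω), hr,
      map_zero]
  · have hdeg : (conjPoly m y).natDegree = Fintype.card (rootsOfUnity m ℂ) := by
      rw [conjPoly, Polynomial.natDegree_finsetProd_X_sub_C_eq_card, Finset.card_univ]
    rw [← hdeg, ← hf, Polynomial.natDegree_map_eq_of_injective hinj,
      Polynomial.natDegree_map_eq_of_injective hinj]
    -- The degree drops strictly only for `f ≠ 1`, which holds because `f` vanishes at `y`.
    refine Polynomial.natDegree_modByMonic_lt g hfm fun h1 => ?_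
    have h2 := branchHom_orbitPoly hf
    rw [h1, map_one] at h2
    exact one_ne_zero h2

/-! ## The eigenvalues of `γ` -/

section Eigenvalues

variable {d : ℕ} {γ : Matrix (Fin d) (Fin d) O} {x : Fin d → PuiseuxField}

theorem toPuiseux_injective : Function.Injective toPuiseux := fun _ _ h =>
  HahnSeries.ofPowerSeries_injective (Γ := ℚ) (congrArg Subtype.val h)

theorem coe_eval₂_toPuiseux (f : Polynomial O) (z : PuiseuxField) :
    ((f.eval₂ toPuiseux z : PuiseuxField) : HahnSeries ℚ ℂ) =
      f.eval₂ (HahnSeries.ofPowerSeries ℚ ℂ) z := by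
  have h := Polynomial.hom_eval₂ f toPuiseux PuiseuxField.subtype z
  exact h

theorem IsDiagonalization.conj_aeval {g : GL (Fin d) PuiseuxField}
    (hg : (g : Matrix (Fin d) (Fin d) PuiseuxField) * γ.map toPuiseux *
      ((g⁻¹ : GL (Fin d) PuiseuxField) : Matrix (Fin d) (Fin d) PuiseuxField) = Matrix.diagonal x)
    (f : Polynomial O) :
    (g : Matrix (Fin d) (Fin d) PuiseuxField) * (Polynomial.aeval γ f).map toPuiseux *
      ((g⁻¹ : GL (Fin d) PuiseuxField) : Matrix (Fin d) (Fin d) PuiseuxField) =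
      Matrix.diagonal fun i => f.eval₂ toPuiseux (x i) := by
  have hinv : ((g⁻¹ : GL (Fin d) PuiseuxField) : Matrix (Fin d) (Fin d) PuiseuxField) *
      (g : Matrix (Fin d) (Fin d) PuiseuxField) = 1 := by
    rw [← Units.val_mul, inv_mul_cancel, Units.val_one]
  have hinv' : (g : Matrix (Fin d) (Fin d) PuiseuxField) *
      ((g⁻¹ : GL (Fin d) PuiseuxField) : Matrix (Fin d) (Fin d) PuiseuxField) = 1 := by
    rw [← Units.val_mul, mul_inv_cancel, Units.val_one]
  induction f using Polynomial.induction_on with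
  | C a =>
    have h1 : (Polynomial.aeval γ (Polynomial.C a)).map toPuiseux =
        toPuiseux a • (1 : Matrix (Fin d) (Fin d) PuiseuxField) := by
      rw [Polynomial.aeval_C, Algebra.algebraMap_eq_smul_one]
      ext i j
      by_cases hij : i = j <;> simp [hij]
    rw [h1, Matrix.mul_smul, mul_one, Matrix.smul_mul, hinv', Matrix.smul_one_eq_diagonal]
    simp
  | add f g hf hg =>
    rw [map_add, Matrix.map_add _ (map_add toPuiseux), mul_add, add_mul, hf, hg,
      Matrix.diagonal_add]
    simp
  | monomial n a ih =>
    rw [pow_succ, ← mul_assoc, map_mul, Polynomial.aeval_X, Matrix.map_mul]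
    have h2 : ∀ M N : Matrix (Fin d) (Fin d) PuiseuxField,
        (g : Matrix (Fin d) (Fin d) PuiseuxField) * (M * N) *
          ((g⁻¹ : GL (Fin d) PuiseuxField) : Matrix (Fin d) (Fin d) PuiseuxField) =
        ((g : Matrix (Fin d) (Fin d) PuiseuxField) * M *
          ((g⁻¹ : GL (Fin d) PuiseuxField) : Matrix (Fin d) (Fin d) PuiseuxField)) *
        ((g : Matrix (Fin d) (Fin d) PuiseuxField) * N *
          ((g⁻¹ : GL (Fin d) PuiseuxField) : Matrix (Fin d) (Fin d) PuiseuxField)) := by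
      intro M N
      calc _ = (g : Matrix (Fin d) (Fin d) PuiseuxField) * M * 1 * N *
          ((g⁻¹ : GL (Fin d) PuiseuxField) : Matrix (Fin d) (Fin d) PuiseuxField) := by
            rw [mul_one]; simp only [mul_assoc]
        _ = _ := by rw [← hinv]; simp only [mul_assoc]
    rw [h2, ih, hg, Matrix.diagonal_mul_diagonal]
    simp

/-- Conjugation turns `f(γ)` into the diagonal matrix of the values `f(x i)`. This presents `𝒪[γ]`
as the quotient of `𝒪[Y]` by the polynomials that vanish at all eigenvalues. -/
theorem aeval_eq_zero_iff (hx : IsDiagonalization γ x) (f : Polynomial O) :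
    Polynomial.aeval γ f = 0 ↔ ∀ i, f.eval₂ toPuiseux (x i) = 0 := by
  obtain ⟨g, hg⟩ := hx
  have h1 := IsDiagonalization.conj_aeval hg f
  constructor
  · intro h i
    rw [h, Matrix.map_zero _ (map_zero toPuiseux), mul_zero, zero_mul] at h1
    have := congrFun (congrFun h1.symm i) i
    simpa using this
  · intro h
    simp only [h, Matrix.diagonal_zero] at h1
    rw [Units.mul_left_eq_zero, Units.mul_right_eq_zero] at h1
    ext1 i j
    refine toPuiseux_injective ?_
    have := congrFun (congrFun h1 i) j
    simpa using this

theorem IsDiagonalization.eval₂_charpoly (hx : IsDiagonalization γ x) (i : Fin d) :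
    γ.charpoly.eval₂ toPuiseux (x i) = 0 :=
  (aeval_eq_zero_iff hx _).1 (Matrix.aeval_self_charpoly γ) i

/-- An injective map from `R` to a field extends to its fraction field, and separability is
preserved by base change. This carries the hypothesis over `F` to the field of Puiseux series. -/
theorem separable_map_of_separable_map_fractionRing {R K L : Type*} [CommRing R] [IsDomain R]
    [Field K] [Algebra R K] [IsFractionRing R K] [Field L] {φ : R →+* L}
    (hφ : Function.Injective φ) {f : Polynomial R} (hf : (f.map (algebraMap R K)).Separable) :
    (f.map φ).Separable := by
  have h : (IsFractionRing.lift (K := K) hφ).comp (algebraMap R K) = φ := by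
    ext1 a
    exact IsFractionRing.lift_algebraMap hφ a
  rw [← h, ← Polynomial.map_map]
  exact hf.map

theorem IsDiagonalization.charpoly_map (hx : IsDiagonalization γ x) :
    γ.charpoly.map toPuiseux = ∏ i, (Polynomial.X - Polynomial.C (x i)) := by
  obtain ⟨g, hg⟩ := hx
  rw [← Matrix.charpoly_diagonal, ← hg, Matrix.coe_units_inv, Matrix.charpoly_units_conj]
  exact (Matrix.charpoly_map γ toPuiseux).symm

theorem IsDiagonalization.injective (hx : IsDiagonalization γ x) (hγ : IsRegularSemisimple γ) :
    Function.Injective x := by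
  rw [IsRegularSemisimple, Matrix.charpoly_map] at hγ
  have h2 := separable_map_of_separable_map_fractionRing toPuiseux_injective hγ
  rw [hx.charpoly_map] at h2
  exact Polynomial.separable_prod_X_sub_C_iff.1 h2

/-- The value of the orbit polynomial of `y`. -/
theorem eval₂_orbitPoly {m : ℕ} [NeZero m] {y : PowerSeries ℂ} {f : Polynomial O}
    (hf : f.map (expand m (NeZero.ne m) : PowerSeries ℂ →ₐ[ℂ] PowerSeries ℂ).toRingHom =
      conjPoly m y) (z : PuiseuxField) :
    ((f.eval₂ toPuiseux z : PuiseuxField) : HahnSeries ℚ ℂ) =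
      ∏ ω : rootsOfUnity m ℂ,
        ((z : HahnSeries ℚ ℂ) - rootSeries m (rescale ((ω : ℂˣ) : ℂ) y)) := by
  have h1 : f.map (HahnSeries.ofPowerSeries ℚ ℂ) = (conjPoly m y).map (rootSeries m) := by
    rw [← hf, Polynomial.map_map]
    congr 1
    ext1 a
    exact (rootSeries_expand m a).symm
  rw [coe_eval₂_toPuiseux, ← Polynomial.eval_map, h1, conjPoly, Polynomial.map_prod,
    Polynomial.eval_prod]
  simp

/-! ## Elements of `𝒪[γ]` -/

/-- The inclusion of `𝒪[γ]` in the matrix algebra. -/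
noncomputable def OrderRing.val (γ : Matrix (Fin d) (Fin d) O) :
    OrderRing γ →ₐ[O] Matrix (Fin d) (Fin d) O :=
  (Algebra.adjoin O ({γ} : Set (Matrix (Fin d) (Fin d) O))).val

theorem OrderRing.val_injective (γ : Matrix (Fin d) (Fin d) O) :
    Function.Injective (OrderRing.val γ) := Subtype.val_injective

theorem OrderRing.val_aeval_gen (f : Polynomial O) :
    OrderRing.val γ (Polynomial.aeval (OrderRing.gen γ) f) = Polynomial.aeval γ f := by
  rw [← Polynomial.aeval_algHom_apply]
  rfl

theorem OrderRing.aeval_gen_surjective (γ : Matrix (Fin d) (Fin d) O) :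
    Function.Surjective (Polynomial.aeval (R := O) (OrderRing.gen γ)) := by
  intro a
  have ha : OrderRing.val γ a ∈ Algebra.adjoin O ({γ} : Set (Matrix (Fin d) (Fin d) O)) := a.2
  rw [Algebra.adjoin_singleton_eq_range_aeval] at ha
  obtain ⟨f, hf⟩ := ha
  exact ⟨f, OrderRing.val_injective γ ((OrderRing.val_aeval_gen f).trans hf)⟩

theorem OrderRing.aeval_gen_eq_zero_iff (hx : IsDiagonalization γ x) (f : Polynomial O) :
    Polynomial.aeval (OrderRing.gen γ) f = 0 ↔ ∀ i, f.eval₂ toPuiseux (x i) = 0 := by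
  rw [← aeval_eq_zero_iff hx, ← OrderRing.val_aeval_gen,
    map_eq_zero_iff _ (OrderRing.val_injective γ)]

theorem OrderRing.algebraMap_complex (c : ℂ) :
    algebraMap ℂ (OrderRing γ) c = algebraMap O (OrderRing γ) (C c) := by
  refine OrderRing.val_injective γ ?_
  rw [AlgHom.commutes]
  exact IsScalarTower.algebraMap_apply ℂ O (Matrix (Fin d) (Fin d) O) c

/-- Evaluation at `γ`, as a homomorphism of `ℂ`-algebras. -/
noncomputable def OrderRing.aevalGen (γ : Matrix (Fin d) (Fin d) O) :
    Polynomial O →ₐ[ℂ] OrderRing γ :=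
  { (Polynomial.aeval (R := O) (OrderRing.gen γ)).toRingHom with
    commutes' := fun c => by
      rw [OrderRing.algebraMap_complex]
      exact (Polynomial.aeval (R := O) (OrderRing.gen γ)).commutes (C c) }

theorem IsBranchAt.ideal_eq {z : PuiseuxField} {P Q : Ideal (OrderRing γ)} (hP : IsBranchAt γ z P)
    (hQ : IsBranchAt γ z Q) : P = Q := by
  ext a
  obtain ⟨f, rfl⟩ := OrderRing.aeval_gen_surjective γ a
  rw [hP f, hQ f]

end Eigenvalues

/-! ## Branches of `𝒪[γ]` and their parametrizations -/

/-- The size of the orbit of `i` under the permutation `w`. -/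
noncomputable def orbitSize {d : ℕ} (w : Equiv.Perm (Fin d)) (i : Fin d) : ℕ :=
  Function.minimalPeriod w i

instance {d : ℕ} (w : Equiv.Perm (Fin d)) (i : Fin d) : NeZero (orbitSize w i) :=
  ⟨(Function.minimalPeriod_pos_of_mem_periodicPts
    (w.injective.mem_periodicPts i)).ne'⟩

theorem order_finset_prod {ι : Type*} (s : Finset ι) (f : ι → HahnSeries ℚ ℂ)
    (h : ∀ i ∈ s, f i ≠ 0) : (∏ i ∈ s, f i).order = ∑ i ∈ s, (f i).order := by
  classical
  induction s using Finset.induction_on with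
  | empty => simp
  | insert a s ha ih =>
    have h1 := fun i hi => h i (Finset.mem_insert_of_mem hi)
    rw [Finset.prod_insert ha, Finset.sum_insert ha, HahnSeries.order_mul
      (h a (Finset.mem_insert_self a s)) (Finset.prod_ne_zero_iff.2 h1), ih h1]

/-- Read at `w i`, the condition `w (τ x) = x` is `τ (x i) = x (w i)`. -/
theorem IsPairOf.tau_iterate {ζ : ℕ → ℂ} {d : ℕ} {x : Fin d → PuiseuxField} {p : RootPair d}
    (hp : IsPairOf ζ x p) (k : ℕ) (i : Fin d) :
    (tau ζ)^[k] (x i : HahnSeries ℚ ℂ) = (x (p.1^[k] i) : HahnSeries ℚ ℂ) := by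
  induction k with
  | zero => rfl
  | succ k ih =>
    rw [Function.iterate_succ_apply', Function.iterate_succ_apply', ih,
      ← hp.1 (p.1 (p.1^[k] i)), show p.1⁻¹ (p.1 (p.1^[k] i)) = _ from p.1.symm_apply_apply _]

/-- Eigenvalues of a regular semisimple `γ` with their pair `(w, r)`, and their expansions as power
series in `ε^{1/m}`, where `m` is the size of the orbit under `w`. -/
structure EigenSeries (ζ : ℕ → ℂ) {d : ℕ} (γ : Matrix (Fin d) (Fin d) O)
    (x : Fin d → PuiseuxField) (p : RootPair d) (y : Fin d → PowerSeries ℂ) : Prop where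
  roots : IsCompatibleRoots ζ
  injective : Function.Injective x
  diag : IsDiagonalization γ x
  pair : IsPairOf ζ x p
  series : ∀ i, rootSeries (orbitSize p.1 i) (y i) = x i

theorem exists_eigenSeries {ζ : ℕ → ℂ} (hζ : IsCompatibleRoots ζ) {d : ℕ}
    {γ : Matrix (Fin d) (Fin d) O} (hγ : IsRegularSemisimple γ) {x : Fin d → PuiseuxField}
    {p : RootPair d} (hx : IsDiagonalization γ x) (hp : IsPairOf ζ x p) :
    ∃ y, EigenSeries ζ γ x p y := by
  have h : ∀ i, ∃ y, rootSeries (orbitSize p.1 i) y = x i := by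
    intro i
    refine exists_rootSeries_eq hζ _ ?_ (Matrix.charpoly_monic γ) ?_
    · rw [hp.tau_iterate]
      exact congrArg (fun j => (x j : HahnSeries ℚ ℂ)) (Function.iterate_minimalPeriod)
    · rw [← coe_eval₂_toPuiseux, hx.eval₂_charpoly i]
      rfl
  choose y hy using h
  exact ⟨y, hζ, hx.injective hγ, hx, hp, hy⟩

namespace EigenSeries

variable {ζ : ℕ → ℂ} {d : ℕ} {γ γ' : Matrix (Fin d) (Fin d) O} {x x' : Fin d → PuiseuxField}
  {p : RootPair d} {y y' : Fin d → PowerSeries ℂ}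

theorem rootSeries_rescale (h : EigenSeries ζ γ x p y) (i : Fin d) (k : ℕ) :
    rootSeries (orbitSize p.1 i) (rescale (ζ (orbitSize p.1 i) ^ k) (y i)) = x (p.1^[k] i) := by
  rw [← h.pair.tau_iterate, ← h.series]
  induction k with
  | zero => simp
  | succ k ih =>
    rw [Function.iterate_succ_apply', ← ih, tau_rootSeries h.roots, rescale_rescale, ← pow_succ]

theorem exists_pow_eq (h : EigenSeries ζ γ x p y) (i : Fin d) {ω : ℂ}
    (hω : ω ^ orbitSize p.1 i = 1) : ∃ k < orbitSize p.1 i, ζ (orbitSize p.1 i) ^ k = ω :=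
  (h.roots.1 _ (NeZero.pos _)).eq_pow_of_pow_eq_one hω

theorem iterate_ne (i : Fin d) {k : ℕ} (hk : k < orbitSize p.1 i) (hk0 : k ≠ 0) :
    p.1^[k] i ≠ i :=
  Function.not_isPeriodicPt_of_pos_of_lt_minimalPeriod hk0 hk

theorem rescale_ne (h : EigenSeries ζ γ x p y) (i : Fin d) (ω : ℂ)
    (hω : ω ^ orbitSize p.1 i = 1) (hω1 : ω ≠ 1) : rescale ω (y i) ≠ y i := by
  obtain ⟨k, hk, rfl⟩ := h.exists_pow_eq i hω
  intro h1
  have h2 := h.rootSeries_rescale i k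
  rw [h1, h.series] at h2
  refine iterate_ne (p := p) i hk ?_ (h.injective (Subtype.ext h2)).symm
  rintro rfl
  exact hω1 (pow_zero _)

/-- If `ω = ζ_m^k` with `m` the orbit size, then `y(ωt) - y(t)` is the expansion of `x (w^k i) - x
i`. Its order is `m` times `r(w^k i, i)`, which depends only on the pair `p`. -/
theorem order_rescale_eq (h : EigenSeries ζ γ x p y) (h' : EigenSeries ζ γ' x' p y') (i : Fin d)
    (ω : ℂ) (hω : ω ^ orbitSize p.1 i = 1) :
    (rescale ω (y i) - y i).order = (rescale ω (y' i) - y' i).order := by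
  by_cases hω1 : ω = 1
  · simp [hω1]
  have hm : (orbitSize p.1 i : ℚ) ≠ 0 := Nat.cast_ne_zero.2 (NeZero.ne _)
  have key : ∀ {γ : Matrix (Fin d) (Fin d) O} {x : Fin d → PuiseuxField}
      {y : Fin d → PowerSeries ℂ}, EigenSeries ζ γ x p y → ∀ k, ∀ hk : p.1^[k] i ≠ i,
      ζ (orbitSize p.1 i) ^ k = ω → ((rescale ω (y i) - y i).order.toNat : ℚ) / orbitSize p.1 i =
        p.2 ⟨(p.1^[k] i, i), hk⟩ := by
    intro γ x y h k hk hkω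
    rw [← rootSeries_order _ (sub_ne_zero.2 (h.rescale_ne i ω hω hω1)), map_sub, ← hkω,
      h.rootSeries_rescale, h.series, h.pair.2]
    rfl
  obtain ⟨k, hk, hkω⟩ := h.exists_pow_eq i hω
  have hk0 : k ≠ 0 := by
    rintro rfl
    exact hω1 (hkω.symm.trans (pow_zero _))
  have h1 := (key h k (iterate_ne i hk hk0) hkω).trans (key h' k (iterate_ne i hk hk0) hkω).symm
  rw [div_left_inj' hm, Nat.cast_inj] at h1
  rw [← coe_toNat_order (sub_ne_zero.2 (h.rescale_ne i ω hω hω1)), h1,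
    coe_toNat_order (sub_ne_zero.2 (h'.rescale_ne i ω hω hω1))]

theorem rootSeries_branchHom (h : EigenSeries ζ γ x p y) (i : Fin d) (f : Polynomial O) :
    rootSeries (orbitSize p.1 i) (branchHom (orbitSize p.1 i) (y i) f) =
      (f.eval₂ toPuiseux (x i) : PuiseuxField) := by
  rw [branchHom_apply, Polynomial.hom_eval₂, h.series, coe_eval₂_toPuiseux]
  congr 1
  ext1 a
  exact rootSeries_expand _ a

theorem branchHom_eq_zero_iff (h : EigenSeries ζ γ x p y) (i : Fin d) (f : Polynomial O) :
    branchHom (orbitSize p.1 i) (y i) f = 0 ↔ f.eval₂ toPuiseux (x i) = 0 := by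
  rw [← map_eq_zero_iff _ (rootSeries_injective (orbitSize p.1 i)), h.rootSeries_branchHom]
  exact ZeroMemClass.coe_eq_zero

/-- The homomorphism `𝒪[γ] → ℂ⟦t⟧` which parametrizes the `i`-th branch. -/
theorem exists_parametrization (h : EigenSeries ζ γ x p y) (i : Fin d) :
    ∃ Φ : OrderRing γ →ₐ[ℂ] PowerSeries ℂ,
      ∀ f, Φ (Polynomial.aeval (OrderRing.gen γ) f) = branchHom (orbitSize p.1 i) (y i) f := by
  have hker : ∀ f, f ∈ RingHom.ker (OrderRing.aevalGen γ) →
      branchHom (orbitSize p.1 i) (y i) f = 0 := fun f hf =>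
    (h.branchHom_eq_zero_iff i f).2 ((OrderRing.aeval_gen_eq_zero_iff h.diag f).1 hf i)
  set E := Ideal.quotientKerAlgEquivOfSurjective (f := OrderRing.aevalGen γ)
    (OrderRing.aeval_gen_surjective γ) with hE
  refine ⟨(Ideal.Quotient.liftₐ _ (branchHom (orbitSize p.1 i) (y i)) hker).comp E.symm.toAlgHom,
    fun f => ?_⟩
  have h1 : E.symm (Polynomial.aeval (OrderRing.gen γ) f) = Ideal.Quotient.mk _ f := by
    rw [AlgEquiv.symm_apply_eq, hE]
    rfl
  change Ideal.Quotient.liftₐ _ (branchHom (orbitSize p.1 i) (y i)) hker (E.symm _) = _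
  rw [h1]
  rfl

/-- The parametrization of the `i`-th branch. -/
noncomputable def param (h : EigenSeries ζ γ x p y) (i : Fin d) :
    OrderRing γ →ₐ[ℂ] PowerSeries ℂ :=
  (h.exists_parametrization i).choose

theorem param_aeval (h : EigenSeries ζ γ x p y) (i : Fin d) (f : Polynomial O) :
    h.param i (Polynomial.aeval (OrderRing.gen γ) f) = branchHom (orbitSize p.1 i) (y i) f :=
  (h.exists_parametrization i).choose_spec f

theorem range_param (h : EigenSeries ζ γ x p y) (i : Fin d) :
    (h.param i).range = (branchHom (orbitSize p.1 i) (y i)).range := by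
  ext v
  constructor
  · rintro ⟨a, rfl⟩
    obtain ⟨f, rfl⟩ := OrderRing.aeval_gen_surjective γ a
    exact ⟨f, (h.param_aeval i f).symm⟩
  · rintro ⟨f, rfl⟩
    exact ⟨_, h.param_aeval i f⟩

theorem aeval_mem_ker_param (h : EigenSeries ζ γ x p y) (i : Fin d) (f : Polynomial O) :
    Polynomial.aeval (OrderRing.gen γ) f ∈ RingHom.ker (h.param i) ↔
      f.eval₂ toPuiseux (x i) = 0 := by
  rw [RingHom.mem_ker, h.param_aeval, h.branchHom_eq_zero_iff]

theorem isBranchAt_ker_param (h : EigenSeries ζ γ x p y) (i : Fin d) :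
    IsBranchAt γ (x i) (RingHom.ker (h.param i)) :=
  h.aeval_mem_ker_param i

/-- The value of `f` at `x (w^k i)` arises from its value at `x i` by the injective substitution `t
↦ ωt`, because the coefficients of `f` become series in `t^m`. -/
theorem ker_param_iterate (h : EigenSeries ζ γ x p y) (i : Fin d) (k : ℕ) :
    RingHom.ker (h.param i) = RingHom.ker (h.param (p.1^[k] i)) := by
  ext a
  obtain ⟨f, rfl⟩ := OrderRing.aeval_gen_surjective γ a
  rw [h.aeval_mem_ker_param, h.aeval_mem_ker_param]
  have hω : (ζ (orbitSize p.1 i) ^ k) ^ orbitSize p.1 i = 1 := by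
    rw [← pow_mul, mul_comm, pow_mul, (h.roots.1 _ (NeZero.pos _)).pow_eq_one, one_pow]
  have hω0 : ζ (orbitSize p.1 i) ^ k ≠ 0 := by
    intro h0
    rw [h0, zero_pow (NeZero.ne _)] at hω
    exact zero_ne_one hω
  have h2 : rootSeries (orbitSize p.1 i)
      (rescale (ζ (orbitSize p.1 i) ^ k) (branchHom (orbitSize p.1 i) (y i) f)) =
      (f.eval₂ toPuiseux (x (p.1^[k] i)) : PuiseuxField) := by
    rw [rescale_branchHom hω, branchHom_apply, Polynomial.hom_eval₂, h.rootSeries_rescale,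
      coe_eval₂_toPuiseux]
    congr 1
    ext1 a
    exact rootSeries_expand _ a
  rw [← h.branchHom_eq_zero_iff,
    ← map_eq_zero_iff _ (rescale_injective hω0),
    ← map_eq_zero_iff _ (rootSeries_injective (orbitSize p.1 i)), h2]
  exact ZeroMemClass.coe_eq_zero

/-- The orbit polynomial of `i` lies in the first kernel, so it vanishes at `x j`. Its only roots
are the eigenvalues in the orbit of `i`. -/
theorem exists_iterate_of_ker_param_le (h : EigenSeries ζ γ x p y) {i j : Fin d}
    (hij : RingHom.ker (h.param i) ≤ RingHom.ker (h.param j)) : ∃ k, p.1^[k] i = j := by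
  obtain ⟨f, -, hf⟩ := exists_orbitPoly (m := orbitSize p.1 i) (y i)
  have h1 : f.eval₂ toPuiseux (x i) = 0 := (h.branchHom_eq_zero_iff i f).1 (branchHom_orbitPoly hf)
  rw [← h.aeval_mem_ker_param] at h1
  have h2 := (h.aeval_mem_ker_param j f).1 (hij h1)
  have h3 := eval₂_orbitPoly hf (x j)
  rw [h2, ZeroMemClass.coe_zero, eq_comm, Finset.prod_eq_zero_iff] at h3
  obtain ⟨ω, -, hω⟩ := h3
  obtain ⟨k, -, hk⟩ := h.exists_pow_eq i (coe_rootsOfUnity_pow ω)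
  rw [← hk, h.rootSeries_rescale, sub_eq_zero] at hω
  exact ⟨k, (h.injective (Subtype.ext hω)).symm⟩

theorem ker_param_eq_iff (h : EigenSeries ζ γ x p y) {i j : Fin d} :
    RingHom.ker (h.param i) = RingHom.ker (h.param j) ↔ ∃ k, p.1^[k] i = j := by
  constructor
  · intro hij
    exact h.exists_iterate_of_ker_param_le hij.le
  · rintro ⟨k, rfl⟩
    exact h.ker_param_iterate i k

/-- The kernels intersect in zero, since an element of `𝒪[γ]` that vanishes at all eigenvalues is
zero. A prime containing a finite intersection contains one of its members. -/
theorem exists_ker_param_le (h : EigenSeries ζ γ x p y) (P : Ideal (OrderRing γ)) [P.IsPrime] :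
    ∃ i, RingHom.ker (h.param i) ≤ P := by
  have h1 : (Finset.univ.inf fun i => RingHom.ker (h.param i)) ≤ P := by
    intro a ha
    obtain ⟨f, rfl⟩ := OrderRing.aeval_gen_surjective γ a
    have h2 : Polynomial.aeval (OrderRing.gen γ) f = 0 := by
      refine (OrderRing.aeval_gen_eq_zero_iff h.diag f).2 fun i => ?_
      refine (h.aeval_mem_ker_param i f).1 ?_
      exact (Finset.inf_le (f := fun i => RingHom.ker (h.param i)) (Finset.mem_univ i)) ha
    rw [h2]
    exact P.zero_mem
  obtain ⟨i, -, hi⟩ := (Ideal.IsPrime.inf_le' ‹P.IsPrime›).1 h1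
  exact ⟨i, hi⟩

theorem ker_param_mem_minimalPrimes (h : EigenSeries ζ γ x p y) (i : Fin d) :
    RingHom.ker (h.param i) ∈ minimalPrimes (OrderRing γ) := by
  refine ⟨⟨RingHom.ker_isPrime _, bot_le⟩, fun P hP hPi => ?_⟩
  have := hP.1
  obtain ⟨j, hj⟩ := h.exists_ker_param_le P
  obtain ⟨k, hk⟩ := h.exists_iterate_of_ker_param_le (hj.trans hPi)
  rw [← h.ker_param_eq_iff.2 ⟨k, hk⟩]
  exact hj

/-- The `i`-th branch. -/
noncomputable def branch (h : EigenSeries ζ γ x p y) (i : Fin d) : minimalPrimes (OrderRing γ) :=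
  ⟨RingHom.ker (h.param i), h.ker_param_mem_minimalPrimes i⟩

theorem branch_surjective (h : EigenSeries ζ γ x p y) : Function.Surjective h.branch := by
  intro P
  have := P.2.1.1
  obtain ⟨i, hi⟩ := h.exists_ker_param_le P.1
  exact ⟨i, Subtype.ext (le_antisymm hi (P.2.2 ⟨RingHom.ker_isPrime _, bot_le⟩ hi))⟩

theorem branch_eq_iff (h : EigenSeries ζ γ x p y) {i j : Fin d} :
    h.branch i = h.branch j ↔ ∃ k, p.1^[k] i = j :=
  Subtype.ext_iff.trans h.ker_param_eq_iff

theorem ker_param_eq_span (h : EigenSeries ζ γ x p y) (j : Fin d) {f : Polynomial O}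
    (hfm : f.Monic)
    (hf : f.map (expand (orbitSize p.1 j) (NeZero.ne _) : PowerSeries ℂ →ₐ[ℂ] _).toRingHom =
      conjPoly (orbitSize p.1 j) (y j)) :
    RingHom.ker (h.param j) = Ideal.span {Polynomial.aeval (OrderRing.gen γ) f} := by
  refine le_antisymm (fun a ha => ?_) ?_
  · obtain ⟨g, rfl⟩ := OrderRing.aeval_gen_surjective γ a
    rw [RingHom.mem_ker, h.param_aeval] at ha
    exact Ideal.mem_span_singleton.2
      (map_dvd _ (orbitPoly_dvd (h.rescale_ne j) hf hfm ha))
  · rw [Ideal.span_singleton_le_iff_mem, RingHom.mem_ker, h.param_aeval, branchHom_orbitPoly hf]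

/-- The ideal of branch `j` is generated by its orbit polynomial, whose value at `x i` is the
product of the differences `x i - x j'` over the orbit of `j`. The valuation of this product is a
sum of values of `r`. -/
theorem intersectionNumber_eq (h : EigenSeries ζ γ x p y) (h' : EigenSeries ζ γ' x' p y')
    {i j : Fin d} (hij : ∀ k, p.1^[k] j ≠ i) :
    intersectionNumber (h.branch i).1 (h.branch j).1 =
      intersectionNumber (h'.branch i).1 (h'.branch j).1 := by
  have hm : (orbitSize p.1 i : ℚ) ≠ 0 := Nat.cast_ne_zero.2 (NeZero.ne _)
  -- The exponents `κ ω` depend only on `ζ` and the orbit size. Choosing them once, before treating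
  -- `γ` and `γ'`, makes the two sums of root valuations literally equal.
  have hex : ∀ ω : rootsOfUnity (orbitSize p.1 j) ℂ, ∃ k,
      ζ (orbitSize p.1 j) ^ k = ((ω : ℂˣ) : ℂ) := fun ω =>
    (h.exists_pow_eq j (coe_rootsOfUnity_pow ω)).imp fun k hk => hk.2
  choose κ hκ using hex
  have key : ∀ {γ : Matrix (Fin d) (Fin d) O} {x : Fin d → PuiseuxField}
      {y : Fin d → PowerSeries ℂ} (h : EigenSeries ζ γ x p y), ∃ g : PowerSeries ℂ, g ≠ 0 ∧
      intersectionNumber (h.branch i).1 (h.branch j).1 =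
        Module.length ℂ (PowerSeries ℂ ⧸ (Ideal.span {g}).restrictScalars ℂ) ∧
      (g.order.toNat : ℚ) / orbitSize p.1 i =
        ∑ ω : rootsOfUnity (orbitSize p.1 j) ℂ, p.2 ⟨(i, p.1^[κ ω] j), (hij _).symm⟩ := by
    intro γ x y h
    obtain ⟨f, hfm, hf⟩ := exists_orbitPoly (m := orbitSize p.1 j) (y j)
    have h1 : rootSeries (orbitSize p.1 i) (branchHom (orbitSize p.1 i) (y i) f) =
        ∏ ω : rootsOfUnity (orbitSize p.1 j) ℂ,
          ((x i - x (p.1^[κ ω] j) : PuiseuxField) : HahnSeries ℚ ℂ) := by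
      rw [h.rootSeries_branchHom, eval₂_orbitPoly hf]
      refine Finset.prod_congr rfl fun ω _ => ?_
      rw [← hκ, h.rootSeries_rescale]
      rfl
    have h2 : ∀ ω ∈ (Finset.univ : Finset (rootsOfUnity (orbitSize p.1 j) ℂ)),
        ((x i - x (p.1^[κ ω] j) : PuiseuxField) : HahnSeries ℚ ℂ) ≠ 0 := fun ω _ h0 =>
      hij _ (h.injective (sub_eq_zero.1 (ZeroMemClass.coe_eq_zero.1 h0))).symm
    have h3 : branchHom (orbitSize p.1 i) (y i) f ≠ 0 := by
      rw [← (map_ne_zero_iff _ (rootSeries_injective (orbitSize p.1 i))), h1]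
      exact Finset.prod_ne_zero_iff.2 h2
    refine ⟨branchHom (orbitSize p.1 i) (y i) f, h3, ?_, ?_⟩
    · obtain ⟨N, hN⟩ := exists_conductor_branchHom (h.rescale_ne i)
      rw [← h.range_param i] at hN
      rw [← h.param_aeval]
      exact intersectionNumber_eq_length (h.param i) hN rfl (h.ker_param_eq_span j hfm hf)
        (by rwa [h.param_aeval])
    · rw [← rootSeries_order _ h3, h1, order_finset_prod _ _ h2]
      exact Finset.sum_congr rfl fun ω _ =>
        (h.pair.2 ⟨(i, p.1^[κ ω] j), (hij _).symm⟩).symm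
  obtain ⟨g, hg0, hg, hgo⟩ := key h
  obtain ⟨g', hg0', hg', hgo'⟩ := key h'
  rw [← hgo', div_left_inj' hm, Nat.cast_inj] at hgo
  rw [hg, hg', span_singleton_eq_of_order_eq (f := g) (g := g')
    (by rw [← coe_toNat_order hg0, hgo, coe_toNat_order hg0'])]

/-- The bijection of the branches which matches the eigenvalues. -/
theorem exists_equiv (h : EigenSeries ζ γ x p y) (h' : EigenSeries ζ γ' x' p y') :
    ∃ e : minimalPrimes (OrderRing γ) ≃ minimalPrimes (OrderRing γ'),
      ∀ i, e (h.branch i) = h'.branch i := by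
  have hiff : ∀ i j, h.branch i = h.branch j ↔ h'.branch i = h'.branch j := fun i j =>
    h.branch_eq_iff.trans h'.branch_eq_iff.symm
  have hs := Function.surjInv_eq h.branch_surjective
  have key : ∀ i, h'.branch (Function.surjInv h.branch_surjective (h.branch i)) = h'.branch i :=
    fun i => (hiff _ _).1 (hs _)
  refine ⟨Equiv.ofBijective (fun P => h'.branch (Function.surjInv h.branch_surjective P))
    ⟨fun P Q hPQ => ?_, fun P => ?_⟩, key⟩
  · have := (hiff _ _).2 hPQ
    rwa [hs, hs] at this
  · obtain ⟨i, rfl⟩ := h'.branch_surjective P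
    exact ⟨h.branch i, key i⟩

theorem exists_isEquisingularBijection (h : EigenSeries ζ γ x p y)
    (h' : EigenSeries ζ γ' x' p y') :
    ∃ e : minimalPrimes (OrderRing γ) ≃ minimalPrimes (OrderRing γ'),
      (∀ i P, IsBranchAt γ (x i) P.1 → IsBranchAt γ' (x' i) (e P).1) ∧
        IsEquisingularBijection e := by
  obtain ⟨e, he⟩ := h.exists_equiv h'
  refine ⟨e, fun i P hP => ?_, fun P => ?_, fun P Q hPQ => ?_⟩
  · have h1 : P = h.branch i := Subtype.ext (hP.ideal_eq (h.isBranchAt_ker_param i))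
    rw [h1, he]
    exact h'.isBranchAt_ker_param i
  · obtain ⟨i, rfl⟩ := h.branch_surjective P
    rw [he]
    exact samePuiseuxCharacteristic_of_order_rescale_eq (h.rescale_ne i) (h.order_rescale_eq h' i)
      (h.param i) (h.range_param i) rfl (h'.param i) (h'.range_param i) rfl
  · obtain ⟨i, rfl⟩ := h.branch_surjective P
    obtain ⟨j, rfl⟩ := h.branch_surjective Q
    rw [he, he]
    exact h.intersectionNumber_eq h' fun k hk => hPQ (h.branch_eq_iff.2 ⟨k, hk⟩).symm

end EigenSeries

/-! ## Reordering the eigenvalues -/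

theorem IsDiagonalization.comp_perm {d : ℕ} {γ : Matrix (Fin d) (Fin d) O}
    {x : Fin d → PuiseuxField} (hx : IsDiagonalization γ x) (u : Equiv.Perm (Fin d)) :
    IsDiagonalization γ (x ∘ u) := by
  obtain ⟨g, hg⟩ := hx
  refine ⟨⟨(g : Matrix (Fin d) (Fin d) PuiseuxField).submatrix u (Equiv.refl _),
    ((g⁻¹ : GL (Fin d) PuiseuxField) : Matrix (Fin d) (Fin d) PuiseuxField).submatrix
      (Equiv.refl _) u, ?_, ?_⟩, ?_⟩
  · rw [Matrix.submatrix_mul_equiv, ← Units.val_mul, mul_inv_cancel, Units.val_one,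
      Matrix.submatrix_one_equiv]
  · rw [Matrix.submatrix_mul_equiv, ← Units.val_mul, inv_mul_cancel, Units.val_one,
      Matrix.submatrix_one_equiv]
  · change (g : Matrix (Fin d) (Fin d) PuiseuxField).submatrix u (Equiv.refl _) *
      (γ.map toPuiseux).submatrix (Equiv.refl _) (Equiv.refl _) *
      ((g⁻¹ : GL (Fin d) PuiseuxField) : Matrix (Fin d) (Fin d) PuiseuxField).submatrix
        (Equiv.refl _) u = _
    rw [Matrix.submatrix_mul_equiv, Matrix.submatrix_mul_equiv, hg,
      Matrix.submatrix_diagonal_equiv]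

theorem IsPairOf.permPair {ζ : ℕ → ℂ} {d : ℕ} {x : Fin d → PuiseuxField} {p : RootPair d}
    (hp : IsPairOf ζ x p) (u : Equiv.Perm (Fin d)) :
    IsPairOf ζ (x ∘ (u⁻¹ : Equiv.Perm (Fin d))) (permPair u p) := by
  refine ⟨fun i => ?_, fun α => hp.2 _⟩
  have h1 : (u⁻¹ : Equiv.Perm (Fin d)) ((RootValuation.permPair u p).1⁻¹ i) =
      p.1⁻¹ ((u⁻¹ : Equiv.Perm (Fin d)) i) := by
    simp [RootValuation.permPair, mul_assoc]
  simp only [Function.comp_apply]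
  rw [h1]
  exact hp.1 _

end RootValuation

theorem mainTheorem6 (ζ : ℕ → ℂ) (hζ : RootValuation.IsCompatibleRoots ζ) (d : ℕ)
    (γ γ' : Matrix (Fin d) (Fin d) RootValuation.O)
    (hγ : RootValuation.IsRegularSemisimple γ) (hγ' : RootValuation.IsRegularSemisimple γ')
    (D : RootValuation.RootDatum d)
    (hD : RootValuation.HasRootDatum ζ γ D) (hD' : RootValuation.HasRootDatum ζ γ' D) :
    RootValuation.Equisingular (RootValuation.OrderRing γ) (RootValuation.OrderRing γ') ∧
    -- for orderings of the eigenvalues with the same pair `(w, r)`, the branches at the `i`-th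
    -- eigenvalues correspond to each other
    ∀ (x x' : Fin d → RootValuation.PuiseuxField) (p : RootValuation.RootPair d),
      RootValuation.IsDiagonalization γ x → RootValuation.IsPairOf ζ x p →
      RootValuation.IsDiagonalization γ' x' → RootValuation.IsPairOf ζ x' p →
      ∃ e : minimalPrimes (RootValuation.OrderRing γ) ≃ minimalPrimes (RootValuation.OrderRing γ'),
        (∀ i P, RootValuation.IsBranchAt γ (x i) P.1 →
          RootValuation.IsBranchAt γ' (x' i) (e P).1) ∧
        RootValuation.IsEquisingularBijection e := by
  have key : ∀ (x x' : Fin d → RootValuation.PuiseuxField) (p : RootValuation.RootPair d),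
      RootValuation.IsDiagonalization γ x → RootValuation.IsPairOf ζ x p →
      RootValuation.IsDiagonalization γ' x' → RootValuation.IsPairOf ζ x' p →
      ∃ e : minimalPrimes (RootValuation.OrderRing γ) ≃ minimalPrimes (RootValuation.OrderRing γ'),
        (∀ i P, RootValuation.IsBranchAt γ (x i) P.1 →
          RootValuation.IsBranchAt γ' (x' i) (e P).1) ∧
        RootValuation.IsEquisingularBijection e := by
    intro x x' p hx hp hx' hp'
    obtain ⟨y, h⟩ := RootValuation.exists_eigenSeries hζ hγ hx hp
    obtain ⟨y', h'⟩ := RootValuation.exists_eigenSeries hζ hγ' hx' hp'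
    exact h.exists_isEquisingularBijection h'
  refine ⟨?_, key⟩
  obtain ⟨x, p, hx, hp, rfl⟩ := hD
  obtain ⟨x', p', hx', hp', hpp'⟩ := hD'
  -- Equality of the data gives equal pairs only up to `S_d`; reordering the eigenvalues of `γ` by
  -- `u` makes the pairs equal.
  obtain ⟨u, hu⟩ := Quotient.exact hpp'
  obtain ⟨e, -, he⟩ := key (x ∘ (u⁻¹ : Equiv.Perm (Fin d))) x' p' (hx.comp_perm u⁻¹)
    (by rw [hu]; exact hp.permPair u) hx' hp'
  exact ⟨e, he⟩
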